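/- There are constants $C>0$ and $c\in\mathbb{N}$ and two fixed programs (a learner and a sampler) for a random access machine with bit costs (each elementary operation on natural numbers is charged for the bits it handles; multiplication and division are charged at the schoolbook rate) such that the following holds for every integer $n\ge 2$, every real $0<\epsilon\le 1$ and every $p=(p_1,\dots,p_n)\in[0,1]^n$. Let $f(x)=\sum_{i=1}^n x_i$, let $X=(X_1,\dots,X_n)$ have independent coordinates with $\Pr[X_i=1]=p_i=1-\Pr[X_i=0]$, and let $f(\bar p)$ denote the distribution of $f(X)$ on $\{0,1,\dots,n\}$. The learner is given $n$, $\lceil 1/\epsilon\rceil$ and access to independent samples from $f(\bar p)$. (1) Whatever the samples in $\{0,\dots,n\}$ are, the learner draws at most $C\log(n)\,(1/\epsilon)^c$ samples, performs at most $C\log^2(n)\,(1/\epsilon)^c$ bit operations, and outputs a succinct representation of a hypothesis distribution $\mathcal{H}$ over $\{0,1,\dots,n\}$, namely a histogram with at most $C\log(n)\,(1/\epsilon)^c$ intervals, given as the list of the lengths and the integer weights of consecutive intervals that partition $\{0,\dots,n\}$; $\mathcal H$ gives each interval a probability proportional to its weight and is uniform within each interval. (2) With probability at least $9/10$ over the samples,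 $$d_{\mathrm{TV}}(f(\bar p),\mathcal{H})=\tfrac12\sum_{j=0}^n\bigl|f(\bar p)(j)-\mathcal{H}(j)\bigr|\le\epsilon .$$ (3) Whatever the samples in $\{0,\dots,n\}$ are, the sampler, given only the representation of the $\mathcal H$ that the learner outputs and independent uniformly random bits, outputs a draw from exactly $\mathcal{H}$, always using at most $C\log(n/\epsilon)$ random bits and at most $C(\log n+1/\epsilon)^c$ bit operations. -/

import Mathlib

open MeasureTheory ProbabilityTheory

/-! ### The target distribution: sums of independent Bernoulli variables -/

/-- The product distribution on `{0,1}^n` whose `i`-th bit is `1` with probability `p i`. -/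
noncomputable def productBits {n : ℕ} (p : Fin n → unitInterval) : Measure (Fin n → Bool) :=
  Measure.pi fun i => bernoulliMeasure true false (p i)

/-- The transformation `f x = x_1 + ... + x_n` on bit vectors. -/
def bitSum {n : ℕ} (x : Fin n → Bool) : ℕ := ∑ i, (x i).toNat

/-- The target distribution: the law of `bitSum X` for `X` distributed as `productBits p`. -/
noncomputable def sumOfBernoullis {n : ℕ} (p : Fin n → unitInterval) : Measure ℕ :=
  (productBits p).map bitSum

instance {n : ℕ} (p : Fin n → unitInterval) : IsProbabilityMeasure (productBits p) := by
  unfold productBits; infer_instance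

instance {n : ℕ} (p : Fin n → unitInterval) : IsProbabilityMeasure (sumOfBernoullis p) :=
  Measure.isProbabilityMeasure_map (measurable_of_countable bitSum).aemeasurable

/-- The law of an infinite sequence of independent samples from the target distribution. -/
noncomputable def sampleLaw {n : ℕ} (p : Fin n → unitInterval) : Measure (ℕ → ℕ) :=
  Measure.infinitePi fun _ : ℕ => sumOfBernoullis p

/-- The law of an infinite sequence of independent uniformly random bits. -/
noncomputable def coinLaw : Measure (ℕ → Bool) :=
  Measure.infinitePi fun _ : ℕ => (PMF.uniformOfFintype Bool).toMeasure

/-! ### Algorithms: a random access machine with bit costs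

A program works with finitely many registers and with an unbounded random access memory; both hold
natural numbers of arbitrary size.  It can draw the next item of an external stream (samples for
the learner, random bits for the sampler), and it can append a number to its output.  Every
elementary instruction is charged for the bits that it handles; multiplication and division are
charged for the schoolbook methods. -/

/-- Elementary instructions.  The arguments `x y z` are names of registers. -/
inductive Op : Type
  /-- `x := c` -/
  | const (x c : ℕ)
  /-- `x := y` -/
  | copy (x y : ℕ)
  /-- `x := y + z` -/
  | add (x y z : ℕ)
  /-- `x := max (y - z) 0` -/
  | sub (x y z : ℕ)
  /-- `x := y * z` -/
  | mul (x y z : ℕ)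
  /-- `x := ⌊y / z⌋`, and `x := 0` if `z = 0` -/
  | div (x y z : ℕ)
  /-- `x := mem[y]` -/
  | load (x y : ℕ)
  /-- `mem[x] := y` -/
  | store (x y : ℕ)
  /-- `x :=` the next item of the stream -/
  | draw (x : ℕ)
  /-- append `x` to the output -/
  | emit (x : ℕ)

/-- Programs: the usual control structures over the elementary instructions. -/
inductive Prog : Type
  | skip
  | op (o : Op)
  | seq (a b : Prog)
  /-- if register `x` is non-zero then `a` else `b` -/
  | cond (x : ℕ) (a b : Prog)
  /-- while register `x` is non-zero do `a` -/
  | loop (x : ℕ) (a : Prog)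

/-- Machine states.  `drawn` counts the stream items drawn so far, and `bitOps` the bit operations
performed so far. -/
structure MState : Type where
  reg : ℕ → ℕ
  mem : ℕ → ℕ
  out : List ℕ
  drawn : ℕ
  bitOps : ℕ

namespace MState

/-- The initial state: all registers are `0`, and the input occupies the beginning of an otherwise
zero memory. -/
def init (input : List ℕ) : MState where
  reg := fun _ => 0
  mem := fun i => input.getD i 0
  out := []
  drawn := 0
  bitOps := 0

/-- Charge `t` bit operations. -/
def charge (s : MState) (t : ℕ) : MState := { s with bitOps := s.bitOps + t }

/-- Assign `v` to register `x`. -/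
def set (s : MState) (x v : ℕ) : MState := { s with reg := Function.update s.reg x v }

end MState

/-- The effect and the cost of an elementary instruction, where `ω` is the external stream. -/
def Op.exec (ω : ℕ → ℕ) (s : MState) : Op → MState
  | .const x c => (s.set x c).charge (1 + c.size)
  | .copy x y => (s.set x (s.reg y)).charge (1 + (s.reg y).size)
  | .add x y z => (s.set x (s.reg y + s.reg z)).charge (1 + (s.reg y).size + (s.reg z).size)
  | .sub x y z => (s.set x (s.reg y - s.reg z)).charge (1 + (s.reg y).size + (s.reg z).size)
  | .mul x y z =>
      (s.set x (s.reg y * s.reg z)).charge ((1 + (s.reg y).size) * (1 + (s.reg z).size))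
  | .div x y z =>
      (s.set x (s.reg y / s.reg z)).charge ((1 + (s.reg y).size) * (1 + (s.reg z).size))
  | .load x y =>
      (s.set x (s.mem (s.reg y))).charge (1 + (s.reg y).size + (s.mem (s.reg y)).size)
  | .store x y =>
      { s with mem := Function.update s.mem (s.reg x) (s.reg y) }.charge
        (1 + (s.reg x).size + (s.reg y).size)
  | .draw x =>
      { s.set x (ω s.drawn) with drawn := s.drawn + 1 }.charge (1 + (ω s.drawn).size)
  | .emit x => { s with out := s.out ++ [s.reg x] }.charge (1 + (s.reg x).size)

/-- `Exec ω P s t`: the program `P`, started in state `s` with stream `ω`, halts in state `t`. -/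
inductive Exec (ω : ℕ → ℕ) : Prog → MState → MState → Prop
  | skip (s : MState) : Exec ω .skip s s
  | op (o : Op) (s : MState) : Exec ω (.op o) s (o.exec ω s)
  | seq {a b : Prog} {s t u : MState} (ha : Exec ω a s t) (hb : Exec ω b t u) :
      Exec ω (.seq a b) s u
  | cond_true {x : ℕ} {a b : Prog} {s t : MState} (hx : s.reg x ≠ 0)
      (ha : Exec ω a (s.charge (1 + (s.reg x).size)) t) : Exec ω (.cond x a b) s t
  | cond_false {x : ℕ} {a b : Prog} {s t : MState} (hx : s.reg x = 0)
      (hb : Exec ω b (s.charge 1) t) : Exec ω (.cond x a b) s t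
  | loop_done {x : ℕ} {a : Prog} {s : MState} (hx : s.reg x = 0) :
      Exec ω (.loop x a) s (s.charge 1)
  | loop_step {x : ℕ} {a : Prog} {s t u : MState} (hx : s.reg x ≠ 0)
      (ha : Exec ω a (s.charge (1 + (s.reg x).size)) t) (hl : Exec ω (.loop x a) t u) :
      Exec ω (.loop x a) s u

/-- `Prog.Runs P input ω t`: on the given input and stream, `P` halts in state `t`. -/
def Prog.Runs (P : Prog) (input : List ℕ) (ω : ℕ → ℕ) (t : MState) : Prop :=
  Exec ω P (MState.init input) t

/-! ### Histogram hypotheses -/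

/-- A succinctly represented histogram on an initial segment of `ℕ`.  An item `(l, w)` of `bins`
is an interval of `l` consecutive points with weight `w`; the intervals follow one another,
starting at the point `0`. -/
structure Histogram : Type where
  bins : List (ℕ × ℕ)

namespace Histogram

/-- The sum of all weights. -/
def totalWeight (H : Histogram) : ℕ := (H.bins.map Prod.snd).sum

/-- The histogram is one over `{0, ..., n}`: its intervals are non-empty and partition
`{0, ..., n}`, and its weights are not all zero. -/
def IsOver (H : Histogram) (n : ℕ) : Prop :=
  (∀ b ∈ H.bins, 0 < b.1) ∧ (H.bins.map Prod.fst).sum = n + 1 ∧ 0 < H.totalWeight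

/-- The weight of the point `j` in a list of intervals: the weight of the interval that contains
`j`, divided by the length of that interval. -/
noncomputable def pointWeight : List (ℕ × ℕ) → ℕ → ℝ
  | [], _ => 0
  | (l, w) :: bs, j => if j < l then (w : ℝ) / l else pointWeight bs (j - l)

/-- The hypothesis distribution: each interval has the probability `weight / totalWeight`, and the
distribution is uniform within each interval. -/
noncomputable def prob (H : Histogram) (j : ℕ) : ℝ := pointWeight H.bins j / H.totalWeight

/-- The representation handled by programs: the number of intervals, followed by the length and the
weight of each interval. -/
def encode (H : Histogram) : List ℕ :=
  H.bins.length :: H.bins.flatMap fun b => [b.1, b.2]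

/-- The program `S`, given the representation of `H` and independent uniformly random bits,
produces a draw from the distribution `H` on `{0, ..., n}`; whatever the random bits are, it uses at
most `r` of them and performs at most `t` bit operations. -/
def SampledBy (H : Histogram) (n : ℕ) (S : Prog) (r t : ℝ) : Prop :=
  (∀ b : ℕ → Bool, ∃ s : MState, S.Runs H.encode (fun i => (b i).toNat) s ∧
      (∃ j ≤ n, s.out = [j]) ∧ (s.drawn : ℝ) ≤ r ∧ (s.bitOps : ℝ) ≤ t) ∧
  ∀ j ≤ n, coinLaw.real {b : ℕ → Bool | ∃ s : MState,
      S.Runs H.encode (fun i => (b i).toNat) s ∧ s.out = [j]} = H.prob j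

/-- The total variation distance between a distribution `μ` on `{0, ..., n}` and `H`. -/
noncomputable def tvDist (n : ℕ) (μ : Measure ℕ) (H : Histogram) : ℝ :=
  (1 / 2) * ∑ j ∈ Finset.range (n + 1), |μ.real {j} - H.prob j|

end Histogram

/-! The law of `f(X)` is log-concave: its generating polynomial is a product of linear factors with
nonnegative coefficients, and multiplication by such a factor preserves log-concavity
(`LogConcave.convolve`). Hence its hazard rate and its reversed hazard rate are monotone. On an
interval of mass at most `δ`, with mass at least `τ` up to its first point and from its last point
on, any two values therefore differ by a factor of at most `1 + δ / τ` (`le_mul_of_mem_Ico`).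
Averaging the law over intervals that are single points or have mass at most `δ` thus costs `O(δ / τ
+ τ + δ)` in `ℓ¹`, where the tails pay for `τ + δ` (`sum_flattening_le`, `sum_flatteningError_le`).

Samples produce such intervals. Each of the first `K` samples becomes a bin of its own, so a longer
bin contains none of them, and uniform convergence of the empirical distribution function makes its
mass small; heavy atoms do no harm. All `M` samples, the first `K` included, then estimate the
masses of the bins. Since the convergence is uniform in the threshold, the breakpoints may depend on
the samples that weigh the bins. Chebyshev's inequality at finitely many quantiles gives this
convergence with a number of samples independent of `n` (`empirical_uniform`). The two scales fail
with probability at most `1 / 20` each.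

Exact sampling is a matter of divisibility. The total weight `R` is a power of two with `R ≥ 4nE`,
where `E = ⌈1/ε⌉`. Each weight is rounded down to a multiple of the length of its bin, and the last
bin `{n}` receives the rest. A uniform number below `R`, read from exactly `log₂ R` bits, then
selects a bin, and its residue modulo the length selects a point (`card_filter_locate`). The
rounding moves a mass of at most `n / R`.

Apart from `O(log (nE))` doublings, the number of instructions of the learner depends on `E` only,
and its numbers have `O(log n)` bits for fixed `E`; schoolbook multiplication then gives the factor
`log² n`. The costs are tracked by `Spec`, and the output of the learner is specified by the
relation `Binned`. -/

/-! ### A program logic for the machine -/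

/-- The machine is deterministic. -/
theorem Exec.deterministic {ω : ℕ → ℕ} {P : Prog} {s t t' : MState} (h : Exec ω P s t)
    (h' : Exec ω P s t') : t = t' := by
  induction h generalizing t' with
  | skip s => cases h'; rfl
  | op o s => cases h'; rfl
  | seq _ _ iha ihb =>
    cases h' with
    | seq ha' hb' =>
      obtain rfl := iha ha'
      exact ihb hb'
  | cond_true hx _ ih =>
    cases h' with
    | cond_true _ h => exact ih h
    | cond_false h _ => exact absurd h hx
  | cond_false hx _ ih =>
    cases h' with
    | cond_true h _ => exact absurd hx h
    | cond_false _ h => exact ih h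
  | loop_done hx =>
    cases h' with
    | loop_done _ => rfl
    | loop_step h _ _ => exact absurd hx h
  | loop_step hx _ _ iha ihl =>
    cases h' with
    | loop_done h => exact absurd h hx
    | loop_step _ ha' hl' =>
      obtain rfl := iha ha'
      exact ihl hl'

/-- A machine state without the count of bit operations. -/
@[ext] structure Config : Type where
  reg : ℕ → ℕ
  mem : ℕ → ℕ
  out : List ℕ
  drawn : ℕ

namespace Config

/-- The machine state with configuration `σ` after `t` bit operations. -/
def withOps (σ : Config) (t : ℕ) : MState := ⟨σ.reg, σ.mem, σ.out, σ.drawn, t⟩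

/-- Assign `v` to register `x`. -/
def set (σ : Config) (x v : ℕ) : Config := { σ with reg := Function.update σ.reg x v }

@[simp] theorem set_mem (σ : Config) (x v : ℕ) : (σ.set x v).mem = σ.mem := rfl
@[simp] theorem set_out (σ : Config) (x v : ℕ) : (σ.set x v).out = σ.out := rfl
@[simp] theorem set_drawn (σ : Config) (x v : ℕ) : (σ.set x v).drawn = σ.drawn := rfl
theorem set_reg (σ : Config) (x v y : ℕ) :
    (σ.set x v).reg y = if y = x then v else σ.reg y := by
  simp [set, Function.update_apply]

end Config

/-- The effect of an elementary instruction on configurations. -/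
def Op.step (ω : ℕ → ℕ) (σ : Config) : Op → Config
  | .const x c => σ.set x c
  | .copy x y => σ.set x (σ.reg y)
  | .add x y z => σ.set x (σ.reg y + σ.reg z)
  | .sub x y z => σ.set x (σ.reg y - σ.reg z)
  | .mul x y z => σ.set x (σ.reg y * σ.reg z)
  | .div x y z => σ.set x (σ.reg y / σ.reg z)
  | .load x y => σ.set x (σ.mem (σ.reg y))
  | .store x y => { σ with mem := Function.update σ.mem (σ.reg x) (σ.reg y) }
  | .draw x => { σ.set x (ω σ.drawn) with drawn := σ.drawn + 1 }
  | .emit x => { σ with out := σ.out ++ [σ.reg x] }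

/-- All numbers that an instruction handles are at most `B`. -/
def Op.Bounded (ω : ℕ → ℕ) (B : ℕ) (σ : Config) : Op → Prop
  | .const _ c => c ≤ B
  | .copy _ y => σ.reg y ≤ B
  | .add _ y z => σ.reg y ≤ B ∧ σ.reg z ≤ B
  | .sub _ y z => σ.reg y ≤ B ∧ σ.reg z ≤ B
  | .mul _ y z => σ.reg y ≤ B ∧ σ.reg z ≤ B
  | .div _ y z => σ.reg y ≤ B ∧ σ.reg z ≤ B
  | .load _ y => σ.reg y ≤ B ∧ σ.mem (σ.reg y) ≤ B
  | .store x y => σ.reg x ≤ B ∧ σ.reg y ≤ B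
  | .draw _ => ω σ.drawn ≤ B
  | .emit x => σ.reg x ≤ B

/-- The cost of an instruction in units of `1 + 2 * B.size` bit operations. -/
def Op.units (B : ℕ) : Op → ℕ
  | .mul _ _ _ => 1 + B.size
  | .div _ _ _ => 1 + B.size
  | _ => 1

/-- A unit `1 + 2 * B.size` pays for touching two numbers up to `B`. A schoolbook product or
quotient fits into `1 + B.size` units because `(1 + B.size) * (1 + B.size) ≤ (1 + B.size) * (1 + 2 *
B.size)`. -/
theorem Op.exec_withOps {ω : ℕ → ℕ} {B : ℕ} {σ : Config} {o : Op} (h : o.Bounded ω B σ) (t : ℕ) :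
    ∃ t' ≤ t + o.units B * (1 + 2 * B.size), o.exec ω (σ.withOps t) = (o.step ω σ).withOps t' := by
  have key : ∀ a b : ℕ, a ≤ B → b ≤ B →
      (1 + a.size) * (1 + b.size) ≤ (1 + B.size) * (1 + 2 * B.size) := fun a b ha hb => by
    have := Nat.size_le_size ha
    have := Nat.size_le_size hb
    apply Nat.mul_le_mul <;> omega
  cases o <;> simp only [Op.Bounded] at h <;>
    simp only [Op.exec, Op.step, Op.units, Config.withOps, Config.set, MState.set, MState.charge]
  all_goals refine ⟨_, ?_, rfl⟩
  case mul => exact Nat.add_le_add_left (key _ _ h.1 h.2) _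
  case div => exact Nat.add_le_add_left (key _ _ h.1 h.2) _
  case const => have := Nat.size_le_size h; omega
  case copy => have := Nat.size_le_size h; omega
  case draw => have := Nat.size_le_size h; omega
  case emit => have := Nat.size_le_size h; omega
  all_goals
    have := Nat.size_le_size h.1
    have := Nat.size_le_size h.2
    omega

/-- `Spec ω B P σ k Q`: started in `σ`, the program `P` halts in a configuration with property `Q`
at the cost of at most `k` units of `1 + 2 * B.size` bit operations. -/
def Spec (ω : ℕ → ℕ) (B : ℕ) (P : Prog) (σ : Config) (k : ℕ) (Q : Config → Prop) : Prop :=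
  ∀ t, ∃ τ, Q τ ∧ ∃ t' ≤ t + k * (1 + 2 * B.size), Exec ω P (σ.withOps t) (τ.withOps t')

/-- Sequential composition of a list of programs. -/
def Prog.block : List Prog → Prog
  | [] => .skip
  | p :: ps => .seq p (Prog.block ps)

namespace Spec

variable {ω : ℕ → ℕ} {B : ℕ} {P : Prog} {ps : List Prog} {σ : Config} {k k' : ℕ}
  {Q Q' : Config → Prop}

theorem mono (h : Spec ω B P σ k Q) (hk : k ≤ k') (hQ : ∀ τ, Q τ → Q' τ) :
    Spec ω B P σ k' Q' := by
  intro t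
  obtain ⟨τ, hτ, t', ht', he⟩ := h t
  exact ⟨τ, hQ _ hτ, t', ht'.trans (by gcongr), he⟩

theorem weaken (h : Spec ω B P σ k Q) (hk : k ≤ k') : Spec ω B P σ k' Q :=
  h.mono hk fun _ => id

theorem nil (h : Q σ) : Spec ω B (.block []) σ 0 Q := fun t => ⟨σ, h, t, by simp, .skip _⟩

theorem cons (h : Spec ω B P σ k fun τ => Spec ω B (.block ps) τ k' Q) :
    Spec ω B (.block (P :: ps)) σ (k + k') Q := by
  intro t
  obtain ⟨τ, hτ, t', ht', he⟩ := h t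
  obtain ⟨υ, hυ, t'', ht'', he'⟩ := hτ t'
  refine ⟨υ, hυ, t'', ?_, .seq he he'⟩
  rw [add_mul]; omega

theorem op {o : Op} (h : o.Bounded ω B σ) (hQ : Q (o.step ω σ)) :
    Spec ω B (.op o) σ (o.units B) Q := by
  intro t
  obtain ⟨t', ht', he⟩ := o.exec_withOps h t
  exact ⟨_, hQ, t', ht', he ▸ .op o _⟩

theorem op_cons {o : Op} (h : o.Bounded ω B σ) (hk : Spec ω B (.block ps) (o.step ω σ) k Q) :
    Spec ω B (.block (.op o :: ps)) σ (o.units B + k) Q :=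
  cons (op h hk)

theorem cond {x : ℕ} {a b : Prog} (hx : σ.reg x ≤ B) (ha : σ.reg x ≠ 0 → Spec ω B a σ k Q)
    (hb : σ.reg x = 0 → Spec ω B b σ k Q) : Spec ω B (.cond x a b) σ (1 + k) Q := by
  intro t
  have := Nat.size_le_size hx
  rcases eq_or_ne (σ.reg x) 0 with h0 | h0
  · obtain ⟨τ, hτ, t', ht', he⟩ := hb h0 (t + 1)
    refine ⟨τ, hτ, t', ?_, .cond_false h0 he⟩
    rw [add_mul]; omega
  · obtain ⟨τ, hτ, t', ht', he⟩ := ha h0 (t + (1 + (σ.reg x).size))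
    refine ⟨τ, hτ, t', ?_, .cond_true h0 he⟩
    rw [add_mul]; omega

/-- The rule for loops: `I i` is the invariant when at most `i` iterations remain. -/
theorem loop {x : ℕ} {a : Prog} (I : ℕ → Config → Prop) {N : ℕ} (hI : I N σ)
    (hx : ∀ i τ, I i τ → τ.reg x ≤ B)
    (h0 : ∀ i τ, I i τ → τ.reg x = 0 → Q τ)
    (hs : ∀ i τ, I i τ → τ.reg x ≠ 0 → ∃ j < i, Spec ω B a τ k (I j)) :
    Spec ω B (.loop x a) σ (N * (k + 1) + 1) Q := by
  induction N using Nat.strong_induction_on generalizing σ with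
  | _ N ih =>
    intro t
    have := Nat.size_le_size (hx _ _ hI)
    rcases eq_or_ne (σ.reg x) 0 with hz | hz
    · refine ⟨σ, h0 _ _ hI hz, t + 1, ?_, .loop_done hz⟩
      rw [add_mul]; omega
    · obtain ⟨j, hj, ha⟩ := hs _ _ hI hz
      obtain ⟨τ, hτ, t', ht', he⟩ := ha (t + (1 + (σ.reg x).size))
      obtain ⟨υ, hυ, t'', ht'', he'⟩ := ih j hj hτ t'
      refine ⟨υ, hυ, t'', ?_, .loop_step hz he he'⟩
      have h1 : (j + 1) * ((k + 1) * (1 + 2 * B.size)) ≤ N * ((k + 1) * (1 + 2 * B.size)) := by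
        gcongr; omega
      nlinarith

theorem runs {input : List ℕ}
    (h : Spec ω B P ⟨fun _ => 0, fun i => input.getD i 0, [], 0⟩ k Q) :
    ∃ s, P.Runs input ω s ∧ s.bitOps ≤ k * (1 + 2 * B.size) ∧
      Q ⟨s.reg, s.mem, s.out, s.drawn⟩ := by
  obtain ⟨τ, hτ, t', ht', he⟩ := h 0
  exact ⟨_, he, by simpa [Config.withOps] using ht', hτ⟩

end Spec

/-- The condition under which the straight-line program `os`, started in `σ`, handles only numbers
up to `B` and ends in a configuration with property `Q`. -/
def Op.Post (ω : ℕ → ℕ) (B : ℕ) (Q : Config → Prop) : List Op → Config → Prop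
  | [], σ => Q σ
  | o :: os, σ => o.Bounded ω B σ ∧ Op.Post ω B Q os (o.step ω σ)

/-- A straight-line program. -/
def Prog.straight (os : List Op) : Prog := .block (os.map .op)

/-- Reduces straight-line code to symbolic execution: `Op.Post` unfolds by `simp` into the size
conditions and the final property. -/
theorem Spec.straight {ω : ℕ → ℕ} {B : ℕ} {os : List Op} {σ : Config} {Q : Config → Prop} {k : ℕ}
    (h : Op.Post ω B Q os σ) (hk : (os.map (Op.units B)).sum ≤ k) :
    Spec ω B (.straight os) σ k Q := by
  refine Spec.weaken ?_ hk
  clear hk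
  induction os generalizing σ with
  | nil => exact .nil h
  | cons o os ih => exact .op_cons h.1 (ih h.2)

/-! ### Histograms in memory, and the selection of a point by a number -/

namespace Histogram

/-- The list of bins is stored in memory from address `a` on. -/
def Stored (mem : ℕ → ℕ) : ℕ → List (ℕ × ℕ) → Prop
  | _, [] => True
  | a, b :: bs => mem a = b.1 ∧ mem (a + 1) = b.2 ∧ Stored mem (a + 2) bs

theorem stored_of_getD (mem : ℕ → ℕ) (bs : List (ℕ × ℕ)) (a : ℕ)
    (h : ∀ i, mem (a + i) = (bs.flatMap fun b => [b.1, b.2]).getD i 0) : Stored mem a bs := by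
  induction bs generalizing a with
  | nil => trivial
  | cons b bs ih =>
    refine ⟨by simpa using h 0, by simpa using h 1, ih _ fun i => ?_⟩
    have := h (i + 2)
    simpa [add_assoc, add_comm, add_left_comm] using this

theorem stored_encode (H : Histogram) : Stored (fun i => H.encode.getD i 0) 1 H.bins :=
  stored_of_getD _ _ _ fun i => by simp [encode, add_comm 1 i]

/-- The point selected by the number `u`, where the bin `(l, w)` receives `w` numbers, which it
assigns to its points cyclically. -/
def locate : List (ℕ × ℕ) → ℕ → ℕ
  | [], _ => 0
  | b :: bs, u => if u < b.2 then u % b.1 else b.1 + locate bs (u - b.2)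

/-- The sum of the lengths of a list of bins. -/
def len (bs : List (ℕ × ℕ)) : ℕ := (bs.map Prod.fst).sum

/-- The sum of the weights of a list of bins. -/
def wt (bs : List (ℕ × ℕ)) : ℕ := (bs.map Prod.snd).sum

@[simp] theorem len_nil : len [] = 0 := rfl
@[simp] theorem wt_nil : wt [] = 0 := rfl
@[simp] theorem len_cons (b : ℕ × ℕ) (bs) : len (b :: bs) = b.1 + len bs := by simp [len]
@[simp] theorem wt_cons (b : ℕ × ℕ) (bs) : wt (b :: bs) = b.2 + wt bs := by simp [wt]

end Histogram

/-- The number whose binary digits are the first `t` items of `ω`. -/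
def readBits (ω : ℕ → ℕ) : ℕ → ℕ
  | 0 => 0
  | t + 1 => 2 * readBits ω t + ω t

theorem readBits_lt {ω : ℕ → ℕ} (h : ∀ i, ω i ≤ 1) (t : ℕ) : readBits ω t < 2 ^ t := by
  induction t with
  | zero => simp [readBits]
  | succ t ih => have := h t; rw [readBits, pow_succ]; omega

/-! ### The sampler -/

namespace Sampler

/-- Add up the weights in register `3`. -/
def sumWeights : Prog :=
  .loop 4 (.straight [.add 1 1 2, .add 1 1 2, .load 5 1, .add 3 3 5, .sub 4 4 2])

/-- Read bits into register `7` until they cover all weights. -/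
def drawBits : Prog :=
  .loop 13 (.straight [.draw 5, .add 7 7 7, .add 7 7 5, .add 8 8 8, .sub 13 3 8])

/-- Find the point selected by register `7`. -/
def search : Prog :=
  .loop 10 (.block [.straight [.load 11 1, .add 1 1 2, .load 12 1, .add 1 1 2, .sub 13 12 7],
    .cond 13
      (.straight [.div 5 7 11, .mul 5 5 11, .sub 7 7 5, .add 9 9 7, .emit 9, .const 10 0])
      (.straight [.sub 7 7 12, .add 9 9 11])])

/-- The sampler. -/
def prog : Prog :=
  .block [.straight [.const 2 1, .load 0 5, .copy 4 0], sumWeights,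
    .straight [.const 8 1, .sub 13 3 8], drawBits,
    .straight [.const 1 1, .const 10 1], search]

open Histogram

variable {ω : ℕ → ℕ} {B : ℕ}

/-- The address register points just before the next bin, so two increments reach its weight; hence
`Stored` is asserted at `σ.reg 1 + 1`. -/
theorem sumWeights_spec {bs : List (ℕ × ℕ)} {σ : Config} (hst : Stored σ.mem (σ.reg 1 + 1) bs)
    (hc : σ.reg 4 = bs.length) (h2 : σ.reg 2 = 1) (ha : σ.reg 1 + 2 * bs.length + 1 ≤ B)
    (hw : σ.reg 3 + wt bs ≤ B) :
    Spec ω B sumWeights σ (bs.length * 6 + 1) fun τ =>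
      τ.reg 3 = σ.reg 3 + wt bs ∧ τ.mem = σ.mem ∧ τ.out = σ.out ∧ τ.drawn = σ.drawn ∧
      τ.reg 2 = 1 ∧ τ.reg 7 = σ.reg 7 ∧ τ.reg 9 = σ.reg 9 := by
  refine Spec.loop (k := 5) (fun i τ => ∃ cs, i = cs.length ∧ Stored τ.mem (τ.reg 1 + 1) cs ∧
    τ.reg 4 = cs.length ∧ τ.reg 1 + 2 * cs.length + 1 ≤ B ∧ τ.reg 3 + wt cs = σ.reg 3 + wt bs ∧
    τ.mem = σ.mem ∧ τ.out = σ.out ∧ τ.drawn = σ.drawn ∧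
      τ.reg 2 = 1 ∧ τ.reg 7 = σ.reg 7 ∧ τ.reg 9 = σ.reg 9) ?_ ?_ ?_ ?_
  · exact ⟨bs, by simp_all⟩
  · rintro i τ ⟨cs, h⟩; omega
  · rintro i τ ⟨cs, -, -, h4, -, h3, h⟩ h0
    obtain rfl : cs = [] := List.length_eq_zero_iff.1 (by omega)
    simp at h3
    exact ⟨h3, h⟩
  · rintro i τ ⟨_ | ⟨b, cs⟩, rfl, h1, h4, ha', h3, hm, ho, hd, h2', h7, h9⟩ h0
    · simp at h4; omega
    refine ⟨cs.length, by simp, Spec.straight ?_ (by simp [Op.units])⟩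
    obtain ⟨m1, m2, m3⟩ := h1
    simp only [List.length_cons, wt_cons] at h4 ha' h3
    simp [Op.Post, Op.Bounded, Op.step, Config.set_reg, h2', h4, m2, add_assoc] at m2 ⊢
    refine ⟨by omega, by omega, by omega, by omega, by omega, cs, rfl, ?_⟩
    simp_all [add_assoc]
    omega

/-- Register `8` holds `2 ^ j` after `j` draws and register `13` its truncated distance to the total
weight. The loop therefore stops after exactly `t` bits, whatever they are. -/
theorem drawBits_spec {t : ℕ} {σ : Config} (hω : ∀ i, ω i ≤ 1) (h3 : σ.reg 3 = 2 ^ t)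
    (h8 : σ.reg 8 = 1) (h13 : σ.reg 13 = σ.reg 3 - 1) (h7 : σ.reg 7 = 0) (hd : σ.drawn = 0)
    (hB : 2 ^ t ≤ B) :
    Spec ω B drawBits σ (t * 6 + 1) fun τ =>
      τ.reg 7 = readBits ω t ∧ τ.mem = σ.mem ∧ τ.out = σ.out ∧ τ.drawn = t ∧
      τ.reg 2 = σ.reg 2 ∧ τ.reg 9 = σ.reg 9 := by
  refine Spec.loop (k := 5) (fun i τ => ∃ j, i + j = t ∧ τ.drawn = j ∧ τ.reg 8 = 2 ^ j ∧
    τ.reg 3 = 2 ^ t ∧ τ.reg 13 = 2 ^ t - 2 ^ j ∧ τ.reg 7 = readBits ω j ∧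
    τ.mem = σ.mem ∧ τ.out = σ.out ∧ τ.reg 2 = σ.reg 2 ∧ τ.reg 9 = σ.reg 9) ?_ ?_ ?_ ?_
  · exact ⟨0, by simp_all [readBits]⟩
  · rintro i τ ⟨j, h⟩; omega
  · rintro i τ ⟨j, rfl, h1, h2, h3', h4, h5, h6, h7', h8', h9⟩ h0
    have : i = 0 := by
      by_contra hi
      have := Nat.pow_lt_pow_right (a := 2) (by norm_num) (show j < i + j by omega)
      omega
    subst this
    simp_all
  · rintro i τ ⟨j, hij, h1, h2, h3', h4, h5, h6, h7', h8', h9⟩ h0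
    rcases i with _ | i
    · simp at hij; subst hij; omega
    refine ⟨i, by simp, Spec.straight ?_ (by simp [Op.units])⟩
    have hlt : 2 ^ (j + 1) ≤ 2 ^ t := Nat.pow_le_pow_right (by norm_num) (by omega)
    have hp : 2 ^ (j + 1) = 2 ^ j + 2 ^ j := by ring
    have hr := readBits_lt hω j
    have hb := hω j
    have hq := Nat.one_le_two_pow (n := j)
    simp [Op.Post, Op.Bounded, Op.step, Config.set_reg, h1, h2, h3', h5, h6, h7', h8', h9]
    and_intros
    any_goals omega
    simp only [readBits]; omega

/-- The invariant conserves the answer: register `9` plus the point that the remaining number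
selects among the remaining bins. Since that number stays below the remaining weight, the bins
cannot run out before a point is emitted. -/
theorem search_spec {bs : List (ℕ × ℕ)} {σ : Config} (hst : Stored σ.mem (σ.reg 1) bs)
    (h2 : σ.reg 2 = 1) (ha : σ.reg 1 + 2 * bs.length ≤ B) (h10 : σ.reg 10 = 1)
    (hu : σ.reg 7 < wt bs) (hw : wt bs ≤ B) (hl : σ.reg 9 + len bs ≤ B)
    (ho : σ.out = []) (hp : ∀ b ∈ bs, 0 < b.1) :
    Spec ω B search σ ((bs.length + 1) * (12 + 2 * B.size + 1) + 1) fun τ =>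
      τ.out = [σ.reg 9 + locate bs (σ.reg 7)] ∧ τ.drawn = σ.drawn := by
  have hB1 : 1 ≤ B := by omega
  refine Spec.loop (k := 12 + 2 * B.size) (fun i τ => τ.drawn = σ.drawn ∧
    ((τ.reg 10 = 0 ∧ τ.out = [σ.reg 9 + locate bs (σ.reg 7)]) ∨
     (τ.reg 10 = 1 ∧ τ.reg 2 = 1 ∧ τ.out = [] ∧ ∃ cs, i = cs.length + 1 ∧
      Stored τ.mem (τ.reg 1) cs ∧ τ.reg 1 + 2 * cs.length ≤ B ∧ τ.reg 7 < wt cs ∧ wt cs ≤ B ∧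
      τ.reg 9 + len cs ≤ B ∧ (∀ b ∈ cs, 0 < b.1) ∧
      τ.reg 9 + locate cs (τ.reg 7) = σ.reg 9 + locate bs (σ.reg 7)))) ?_ ?_ ?_ ?_
  · exact ⟨rfl, .inr ⟨h10, h2, ho, bs, rfl, hst, ha, hu, hw, hl, hp, rfl⟩⟩
  · rintro i τ h; omega
  · rintro i τ ⟨hd, h | h⟩ h0
    · exact ⟨h.2, hd⟩
    · omega
  · rintro i τ ⟨hd, h | ⟨h10, h2, ho, cs, rfl, hst, ha, hu, hw, hl, hp, he⟩⟩ h0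
    · omega
    rcases cs with _ | ⟨b, cs⟩
    · simp at hu
    refine ⟨cs.length + 1, by simp, ?_⟩
    obtain ⟨m1, m2, m3⟩ := hst
    simp only [List.length_cons, wt_cons, len_cons] at ha hu hw hl
    refine Spec.weaken (Spec.cons (k := 5) (k' := 7 + 2 * B.size)
      (Spec.straight ?_ (by simp [Op.units])) ) (by omega)
    simp [Op.Post, Op.Bounded, Op.step, Config.set_reg, h2, m1, m2, add_assoc]
    and_intros
    any_goals omega
    refine Spec.weaken (Spec.cons (k := 1 + (6 + 2 * B.size)) (Spec.cond ?_ ?_ ?_))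
      (le_of_eq (add_zero _) |>.trans (by omega))
    · simp [Config.set_reg]; omega
    · intro hc
      simp [Config.set_reg] at hc
      refine Spec.straight ?_ (by simp [Op.units]; omega)
      -- The machine has no remainder instruction; it forms `u % l` as `u - u / l * l`.
      have e1 : τ.reg 7 - τ.reg 7 / b.1 * b.1 = τ.reg 7 % b.1 := by
        rw [mul_comm]; exact Nat.sub_eq_of_eq_add (by rw [Nat.mod_add_div])
      have e2 : τ.reg 7 / b.1 ≤ τ.reg 7 := Nat.div_le_self _ _
      have e3 : τ.reg 7 / b.1 * b.1 ≤ τ.reg 7 := Nat.div_mul_le_self _ _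
      have e4 : τ.reg 9 + τ.reg 7 % b.1 ≤ B := by
        have := Nat.mod_lt (τ.reg 7) (hp b (by simp))
        omega
      simp [Op.Post, Op.Bounded, Op.step, Config.set_reg, e1, ho]
      and_intros
      any_goals omega
      refine Spec.nil ⟨hd, .inl ?_⟩
      simp [Config.set_reg, ← he, locate, show τ.reg 7 < b.2 by omega]
    · intro hc
      simp [Config.set_reg] at hc
      refine Spec.straight ?_ (by simp [Op.units]; omega)
      simp [Op.Post, Op.Bounded, Op.step, Config.set_reg]
      and_intros
      any_goals omega
      refine Spec.nil ⟨hd, .inr ?_⟩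
      simp [Config.set_reg, h10, h2, ho]
      refine ⟨cs, rfl, m3, by omega, by omega, by omega, by omega,
        fun x y h => hp (x, y) (by simp [h]), ?_⟩
      rw [← he, locate, if_neg (by omega)]
      ring

theorem prog_spec {H : Histogram} {t : ℕ} (hω : ∀ i, ω i ≤ 1) (hp : ∀ b ∈ H.bins, 0 < b.1)
    (hw : wt H.bins = 2 ^ t) (hN : 2 * H.bins.length + 1 ≤ B) (hwB : 2 ^ t ≤ B)
    (hl : len H.bins ≤ B) :
    Spec ω B prog ⟨fun _ => 0, fun i => H.encode.getD i 0, [], 0⟩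
      ((H.bins.length + t + 1) * (23 + 2 * B.size)) fun τ =>
        τ.out = [locate H.bins (readBits ω t)] ∧ τ.drawn = t := by
  have hB1 : 1 ≤ B := by omega
  have hst := stored_encode H
  have h0 : H.encode.getD 0 0 = H.bins.length := by simp [encode]
  refine Spec.weaken (Spec.cons (Spec.straight (k := 3) ?_ (by simp [Op.units])))
    (k := 3 + (H.bins.length * 6 + 1 + (2 + (t * 6 + 1 + (2 +
      ((H.bins.length + 1) * (12 + 2 * B.size + 1) + 1 + 0)))))) (by nlinarith)
  simp only [Op.Post, Op.Bounded, Op.step, Config.set_reg, Config.set_mem]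
  simp only [Nat.reduceEqDiff, reduceIte, h0]
  refine ⟨by omega, by omega, by omega, Spec.cons ((sumWeights_spec (bs := H.bins) ?_ ?_ ?_ ?_
    ?_).mono le_rfl ?_)⟩
  · simpa [Config.set_reg] using hst
  · simp [Config.set_reg]
  · simp [Config.set_reg]
  · simp [Config.set_reg]; omega
  · simp [Config.set_reg]; omega
  rintro τ ⟨h3, hm, ho, hd, h2, h7, h9⟩
  simp [Config.set_reg] at h3 hm ho hd h2 h7 h9
  refine Spec.cons (Spec.straight (k := 2) ?_ (by simp [Op.units]))
  simp [Op.Post, Op.Bounded, Op.step, Config.set_reg]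
  refine ⟨by omega, by omega, Spec.cons ((drawBits_spec (t := t) hω ?_ ?_ ?_ ?_ ?_ hwB).mono
    le_rfl ?_)⟩
  · simp [Config.set_reg]; omega
  · simp [Config.set_reg]
  · simp [Config.set_reg]
  · simp [Config.set_reg]; omega
  · simpa using hd
  rintro υ ⟨g7, gm, go, gd, g2, g9⟩
  simp [Config.set_reg] at g7 gm go gd g2 g9
  refine Spec.cons (Spec.straight (k := 2) ?_ (by simp [Op.units]))
  simp [Op.Post, Op.Bounded, Op.step]
  refine ⟨by omega, Spec.cons (k' := 0) ((search_spec (bs := H.bins) ?_ ?_ ?_ ?_ ?_ ?_ ?_ ?_ hp).mono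
    le_rfl ?_)⟩
  · simpa [Config.set_reg, gm, hm] using hst
  · simp [Config.set_reg]; omega
  · simp [Config.set_reg]; omega
  · simp [Config.set_reg]
  · simp [Config.set_reg, g7, hw]; exact readBits_lt hω t
  · omega
  · simp [Config.set_reg, g9, h9, hl]
  · simp [go, ho]
  rintro π ⟨e1, e2⟩
  simp [Config.set_reg, g9, h9, g7, gd] at e1 e2
  exact Spec.nil ⟨e1, e2⟩

end Sampler

/-! ### How many numbers select a given point -/

namespace Histogram

/-- Exactness of the sampler comes from here: among `l * q` consecutive numbers every residue modulo
`l` is equally frequent. -/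
theorem card_filter_mod_eq {l j : ℕ} (hj : j < l) (q : ℕ) :
    ((Finset.range (l * q)).filter (· % l = j)).card = q := by
  have h := Nat.count_modEq_card (b := l * q) (r := l) (by omega) j
  rw [← Nat.count_eq_card_filter_range]
  have h1 : l * q / l = q := Nat.mul_div_cancel_left _ (by omega)
  simp only [Nat.mul_mod_right, h1, Nat.ModEq, Nat.mod_eq_of_lt hj] at h
  simpa using h

/-- Among the numbers below the total weight, each point is selected with its weight. -/
theorem card_filter_locate (bs : List (ℕ × ℕ)) (hp : ∀ b ∈ bs, 0 < b.1)
    (hd : ∀ b ∈ bs, b.1 ∣ b.2) (j : ℕ) :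
    (((Finset.range (wt bs)).filter (locate bs · = j)).card : ℝ) = pointWeight bs j := by
  induction bs generalizing j with
  | nil => simp [pointWeight]
  | cons b bs ih =>
    obtain ⟨l, w⟩ := b
    obtain ⟨q, hq⟩ := hd (l, w) (by simp)
    have hl : 0 < l := hp (l, w) (by simp)
    simp only at hq
    have hsplit : (Finset.range (w + wt bs)).filter (locate ((l, w) :: bs) · = j) =
        (Finset.range w).filter (· % l = j) ∪
        ((Finset.range (wt bs)).filter (fun u => l + locate bs u = j)).map (addLeftEmbedding w) := by
      ext u
      simp only [Finset.mem_filter, Finset.mem_range, Finset.mem_union, Finset.mem_map,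
        addLeftEmbedding_apply, locate]
      constructor
      · rintro ⟨h1, h2⟩
        by_cases h : u < w
        · exact .inl ⟨h, by simpa [h] using h2⟩
        · exact .inr ⟨u - w, ⟨by omega, by simpa [h] using h2⟩, by omega⟩
      · rintro (⟨h1, h2⟩ | ⟨v, ⟨h1, h2⟩, rfl⟩)
        · exact ⟨by omega, by simpa [h1] using h2⟩
        · exact ⟨by omega, by simpa using h2⟩
    rw [wt_cons, hsplit, Finset.card_union_of_disjoint, Finset.card_map]
    · by_cases hj : j < l
      · have h0 : (Finset.range (wt bs)).filter (fun u => l + locate bs u = j) = ∅ := by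
          ext u; simp; omega
        rw [hq, card_filter_mod_eq hj, h0, pointWeight, if_pos hj]
        have : (l : ℝ) ≠ 0 := by positivity
        simp; field_simp
      · have h0 : (Finset.range w).filter (· % l = j) = ∅ := by
          ext u; have := Nat.mod_lt u hl; simp; omega
        have h1 : (Finset.range (wt bs)).filter (fun u => l + locate bs u = j) =
            (Finset.range (wt bs)).filter (locate bs · = j - l) := by
          ext u; simp; omega
        rw [h0, h1, pointWeight, if_neg hj, ← ih (fun b hb => hp b (by simp [hb]))
          (fun b hb => hd b (by simp [hb]))]
        simp
    · rw [Finset.disjoint_left]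
      intro u hu hv
      simp at hu hv
      omega

end Histogram

/-! ### Uniformly random bits -/

instance : IsProbabilityMeasure coinLaw := by unfold coinLaw; infer_instance

theorem coinLaw_real_cylinder (t : ℕ) (a : ℕ → Bool) :
    coinLaw.real {b | ∀ i < t, b i = a i} = (1 / 2) ^ t := by
  have h : {b : ℕ → Bool | ∀ i < t, b i = a i} =
      Set.pi (Finset.range t : Set ℕ) fun i => {a i} := by
    ext b; simp
  rw [measureReal_def, h, coinLaw, Measure.infinitePi_pi _ (fun i _ => measurableSet_singleton _)]
  simp

/-- Binary digits are unique, so each value is a cylinder event. The last bit read is the lowest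
digit, which is why the induction passes to `u / 2`. -/
theorem readBits_eq_iff (t u : ℕ) (hu : u < 2 ^ t) :
    ∃ a : ℕ → Bool, ∀ b : ℕ → Bool,
      readBits (fun i => (b i).toNat) t = u ↔ ∀ i < t, b i = a i := by
  induction t generalizing u with
  | zero => exact ⟨fun _ => false, fun b => by simp at hu; simp [readBits, hu]⟩
  | succ t ih =>
    obtain ⟨a, ha⟩ := ih (u / 2) (by rw [pow_succ] at hu; omega)
    refine ⟨Function.update a t (decide (u % 2 = 1)), fun b => ?_⟩
    have h1 : readBits (fun i => (b i).toNat) (t + 1) = u ↔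
        readBits (fun i => (b i).toNat) t = u / 2 ∧ b t = decide (u % 2 = 1) := by
      rw [readBits]
      cases hb : b t <;> simp <;> omega
    rw [h1, ha]
    constructor
    · rintro ⟨h2, h3⟩ i hi
      rcases Nat.lt_succ_iff_lt_or_eq.1 hi with h | rfl
      · simp [Function.update_of_ne h.ne, h2 i h]
      · simpa using h3
    · intro h
      refine ⟨fun i hi => ?_, by simpa using h t (by omega)⟩
      simpa [Function.update_of_ne hi.ne] using h i (by omega)

theorem coinLaw_real_readBits (t : ℕ) (S : Finset ℕ) (hS : ∀ u ∈ S, u < 2 ^ t) :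
    coinLaw.real {b | readBits (fun i => (b i).toNat) t ∈ S} = S.card / 2 ^ t := by
  have h : {b : ℕ → Bool | readBits (fun i => (b i).toNat) t ∈ S} =
      ⋃ u ∈ S, {b | readBits (fun i => (b i).toNat) t = u} := by
    ext b; simp
  rw [h, measureReal_biUnion_finset]
  · rw [Finset.sum_congr rfl (g := fun _ => (1 / 2 : ℝ) ^ t)]
    · simp [div_eq_mul_inv]
    · intro u hu
      obtain ⟨a, ha⟩ := readBits_eq_iff t u (hS u hu)
      simp_rw [ha]
      exact coinLaw_real_cylinder t a
  · intro u _ v _ huv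
    rw [Function.onFun, Set.disjoint_left]
    rintro b rfl h
    exact huv h
  · intro u hu
    obtain ⟨a, ha⟩ := readBits_eq_iff t u (hS u hu)
    simp_rw [ha]
    measurability

-- The run is determined by the first `t` bits, which encode a uniform number below the total weight
-- `2 ^ t`; the probability of `j` is thus a count of numbers. Divisibility of weights by lengths
-- makes this count the weight of the point.
open Histogram in
theorem Sampler.sampledBy {H : Histogram} {n t B : ℕ} {r T : ℝ} (hH : H.IsOver n)
    (hd : ∀ b ∈ H.bins, b.1 ∣ b.2) (hw : H.totalWeight = 2 ^ t)
    (hN : 2 * H.bins.length + 1 ≤ B) (hwB : 2 ^ t ≤ B) (hl : n + 1 ≤ B) (hr : (t : ℝ) ≤ r)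
    (hT : (((H.bins.length + t + 1) * (23 + 2 * B.size) * (1 + 2 * B.size) : ℕ) : ℝ) ≤ T) :
    H.SampledBy n Sampler.prog r T := by
  obtain ⟨hp, hn, -⟩ := hH
  have hrun : ∀ b : ℕ → Bool, ∃ s, Sampler.prog.Runs H.encode (fun i => (b i).toNat) s ∧
      s.bitOps ≤ (H.bins.length + t + 1) * (23 + 2 * B.size) * (1 + 2 * B.size) ∧
      s.out = [locate H.bins (readBits (fun i => (b i).toNat) t)] ∧ s.drawn = t := fun b =>
    (Sampler.prog_spec (fun i => Bool.toNat_le _) hp hw hN hwB (hn.le.trans hl)).runs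
  have hle : ∀ bs : List (ℕ × ℕ), (∀ b ∈ bs, 0 < b.1) → ∀ u, u < wt bs →
      locate bs u < len bs := by
    intro bs
    induction bs with
    | nil => simp
    | cons b bs ih =>
      intro hp u hu
      have := Nat.mod_lt u (hp b (by simp))
      simp only [locate, len_cons, wt_cons] at hu ⊢
      split_ifs with h
      · omega
      · have := ih (fun b hb => hp b (by simp [hb])) (u - b.2) (by omega)
        omega
  refine ⟨fun b => ?_, fun j hj => ?_⟩
  · obtain ⟨s, h1, h2, h3, h4⟩ := hrun b
    refine ⟨s, h1, ⟨_, ?_, h3⟩, by rwa [h4], le_trans (by exact_mod_cast h2) hT⟩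
    have h5 := hle H.bins hp _ (hw ▸ readBits_lt (fun i => Bool.toNat_le (b i)) t : _ < wt H.bins)
    have : len H.bins = n + 1 := hn
    omega
  · have hset : {b : ℕ → Bool | ∃ s, Sampler.prog.Runs H.encode (fun i => (b i).toNat) s ∧
        s.out = [j]} = {b | readBits (fun i => (b i).toNat) t ∈
          (Finset.range (wt H.bins)).filter (locate H.bins · = j)} := by
      ext b
      obtain ⟨s, h1, h2, h3, h4⟩ := hrun b
      have hlt : readBits (fun i => (b i).toNat) t < wt H.bins :=
        (readBits_lt (fun i => Bool.toNat_le (b i)) t).trans_eq hw.symm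
      simp only [Set.mem_ofPred_eq, Finset.mem_filter, Finset.mem_range, hlt, true_and]
      constructor
      · rintro ⟨s', h1', h2'⟩
        -- Determinism turns the existential event into a condition on the one run already known.
        rw [h1'.deterministic h1, h3] at h2'
        simpa using h2'
      · exact fun h => ⟨s, h1, by rw [h3, h]⟩
    rw [hset, coinLaw_real_readBits t, card_filter_locate _ hp hd, Histogram.prob, hw]
    · simp
    · intro u hu
      exact (Finset.mem_range.1 (Finset.mem_filter.1 hu).1).trans_eq hw

/-! ### The histogram computed by the learner -/

/-- The breakpoints in `{0, ..., n}` defined by the first `K` samples: each sample is an interval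
of its own, and so is `n`. -/
def Breakpoint (y : ℕ → ℕ) (K n v : ℕ) : Prop := v = n ∨ ∃ i < K, v = y i ∨ v = y i + 1

/-- The number of samples in the interval `[a, b)` among the first `M`. -/
def sampleCount (y : ℕ → ℕ) (M a b : ℕ) : ℕ :=
  ((Finset.range M).filter fun i => a ≤ y i ∧ y i < b).card

/-- The weight of the interval `[a, b)`. -/
def binWeight (y : ℕ → ℕ) (M R a b : ℕ) : ℕ :=
  (b - a) * (sampleCount y M a b * R / (M * (b - a)))

/-- `Binned y K M R n a r bs`: the list `bs` consists of the bins of `{a, ..., n}` given by the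
breakpoints, weighted according to the samples, where the last bin `{n}` receives what remains of
the weight `r`. -/
inductive Binned (y : ℕ → ℕ) (K M R n : ℕ) : ℕ → ℕ → List (ℕ × ℕ) → Prop
  | last (r : ℕ) : Binned y K M R n n r [(1, r)]
  | step {a b r : ℕ} {bs : List (ℕ × ℕ)} (ha : a < n)
      (hb : IsLeast {v | a < v ∧ Breakpoint y K n v} b)
      (h : Binned y K M R n b (r - binWeight y M R a b) bs) :
      Binned y K M R n a r ((b - a, binWeight y M R a b) :: bs)

theorem sampleCount_le (y : ℕ → ℕ) (M a b : ℕ) : sampleCount y M a b ≤ M :=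
  (Finset.card_filter_le _ _).trans (by simp)

/-- Weights are rounded down, so they never use more than their empirical share of `R`. -/
theorem mul_binWeight_le (y : ℕ → ℕ) (M R a b : ℕ) :
    M * binWeight y M R a b ≤ sampleCount y M a b * R := by
  rw [binWeight, ← mul_assoc]
  exact Nat.mul_div_le _ _

namespace Binned

variable {y : ℕ → ℕ} {K M R n a r : ℕ} {bs : List (ℕ × ℕ)}

theorem le (h : Binned y K M R n a r bs) : a ≤ n := by
  cases h with
  | last => rfl
  | step ha => exact ha.le

theorem exists_of_le (y : ℕ → ℕ) (K M R : ℕ) (ha : a ≤ n) (r : ℕ) :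
    ∃ bs, Binned y K M R n a r bs := by
  induction hk : n - a using Nat.strong_induction_on generalizing a r with
  | _ k ih =>
    rcases ha.eq_or_lt with rfl | ha
    · exact ⟨_, .last r⟩
    · have hne : {v | a < v ∧ Breakpoint y K n v}.Nonempty := ⟨n, ha, .inl rfl⟩
      have hb : IsLeast {v | a < v ∧ Breakpoint y K n v} (sInf {v | a < v ∧ Breakpoint y K n v}) :=
        ⟨Nat.sInf_mem hne, fun v hv => Nat.sInf_le hv⟩
      have hbn := hb.2 ⟨ha, .inl rfl⟩
      have hab := hb.1.1
      obtain ⟨bs, h⟩ := ih _ (by omega) hbn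
        (r - binWeight y M R a (sInf {v | a < v ∧ Breakpoint y K n v})) rfl
      exact ⟨_, .step ha hb h⟩

theorem length_pos (h : Binned y K M R n a r bs) : 0 < bs.length := by
  cases h <;> simp

theorem fst_pos (h : Binned y K M R n a r bs) : ∀ b ∈ bs, 0 < b.1 := by
  induction h with
  | last => simp
  | step ha hb _ ih =>
    have := hb.1.1
    simp only [List.mem_cons, forall_eq_or_imp]
    exact ⟨by omega, ih⟩

theorem fst_dvd_snd (h : Binned y K M R n a r bs) : ∀ b ∈ bs, b.1 ∣ b.2 := by
  induction h with
  | last => simp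
  | step ha hb _ ih =>
    simp only [List.mem_cons, forall_eq_or_imp]
    exact ⟨Dvd.intro _ rfl, ih⟩

theorem len_eq (h : Binned y K M R n a r bs) : Histogram.len bs = n + 1 - a := by
  induction h with
  | last => simp
  | step ha hb h ih =>
    have := hb.1.1
    have := h.le
    simp [ih]; omega

/-- Each bin but the last ends at a new breakpoint, and there are at most `2 * K + 1` of these: `n`,
the samples and their successors. -/
theorem length_le (h : Binned y K M R n a r bs) : bs.length ≤ 2 * K + 2 := by
  classical
  let S : Finset ℕ := insert n ((Finset.range K).image y ∪ (Finset.range K).image (y · + 1))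
  have hS : ∀ v, Breakpoint y K n v → v ∈ S := by
    rintro v (rfl | ⟨i, hi, rfl | rfl⟩)
    · simp [S]
    · simp only [S, Finset.mem_insert, Finset.mem_union, Finset.mem_image, Finset.mem_range]
      exact .inr (.inl ⟨i, hi, rfl⟩)
    · simp only [S, Finset.mem_insert, Finset.mem_union, Finset.mem_image, Finset.mem_range]
      exact .inr (.inr ⟨i, hi, rfl⟩)
  have hcard : S.card ≤ 2 * K + 1 := by
    refine (Finset.card_insert_le _ _).trans ?_
    have h1 : ((Finset.range K).image y).card ≤ K := Finset.card_image_le.trans (by simp)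
    have h2 : ((Finset.range K).image (y · + 1)).card ≤ K := Finset.card_image_le.trans (by simp)
    have := Finset.card_union_le ((Finset.range K).image y) ((Finset.range K).image (y · + 1))
    omega
  have key : bs.length ≤ (S.filter (a < ·)).card + 1 := by
    clear hcard
    induction h with
    | last => simp
    | @step a b r bs ha hb h ih =>
      have : S.filter (b < ·) ⊂ S.filter (a < ·) := by
        have hab := hb.1.1
        refine (Finset.ssubset_iff_of_subset fun v => ?_).2 ⟨b, ?_, ?_⟩
        · simp only [Finset.mem_filter]
          exact fun h => ⟨h.1, by omega⟩
        · simp [hS b hb.1.2, hab]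
        · simp
      have := Finset.card_lt_card this
      simp only [List.length_cons]
      omega
  have := Finset.card_filter_le S (a < ·)
  omega

end Binned

theorem sampleCount_add (y : ℕ → ℕ) (M : ℕ) {a b c : ℕ} (hab : a ≤ b) (hbc : b ≤ c) :
    sampleCount y M a b + sampleCount y M b c = sampleCount y M a c := by
  rw [sampleCount, sampleCount, sampleCount, ← Finset.card_union_of_disjoint]
  · congr 1
    ext i
    simp only [Finset.mem_union, Finset.mem_filter]
    grind
  · rw [Finset.disjoint_left]
    intro i
    simp only [Finset.mem_filter]
    omega

/-- The hypothesis says that the remaining weight covers the empirical share of `[a, n)`. It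
persists along the bins because of rounding down, so the truncated subtraction in `Binned.step` is a
true one and nothing is lost. -/
theorem Binned.wt_eq {y : ℕ → ℕ} {K M R n a r : ℕ} {bs : List (ℕ × ℕ)}
    (h : Binned y K M R n a r bs) (hM : 0 < M) (hr : sampleCount y M a n * R ≤ M * r) :
    Histogram.wt bs = r := by
  induction h with
  | last => simp
  | @step a b r bs ha hb h ih =>
    have hab := hb.1.1
    have h1 := sampleCount_add y M hab.le h.le
    have h2 := mul_binWeight_le y M R a b
    have h3 : binWeight y M R a b ≤ r := by
      refine Nat.le_of_mul_le_mul_left (h2.trans (le_trans ?_ hr)) hM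
      gcongr
      omega
    rw [Histogram.wt_cons, ih]
    · simp only; omega
    · rw [← h1, add_mul] at hr
      rw [Nat.mul_sub]
      omega

/-! ### The learner -/

namespace Learner

/-- Put the next breakpoint after register `6` into register `7`. -/
def findNext : Prog :=
  .block [.straight [.copy 7 0, .copy 8 3],
    .loop 8 (.block [.straight [.sub 8 8 2, .load 9 8, .add 10 9 2, .sub 10 10 6],
      .cond 10 (.straight [.add 11 6 2, .sub 10 11 9, .add 9 9 10, .sub 10 7 9, .sub 7 7 10])
        (.straight [])])]

/-- Put the number of samples from register `6` up to register `7` into register `12`. -/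
def countSamples : Prog :=
  .block [.straight [.const 12 0, .copy 8 4],
    .loop 8 (.straight [.sub 8 8 2, .load 9 8, .sub 10 6 9, .add 11 9 2, .sub 11 11 7,
      .add 10 10 11, .sub 10 2 10, .add 12 12 10])]

/-- Put the number of bins into register `19`. -/
def countBins : Prog :=
  .loop 13 (.block [findNext, .straight [.add 19 19 2, .copy 6 7, .sub 13 0 6]])

/-- Output all bins but the last one. -/
def emitBins : Prog :=
  .loop 13 (.block [findNext, countSamples,
    .straight [.sub 16 7 6, .mul 17 12 5, .mul 10 4 16, .div 17 17 10, .mul 17 16 17, .emit 16,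
      .emit 17, .sub 15 15 17, .copy 6 7, .sub 13 0 6]])

/-- Compute the total weight in register `5`. -/
def powerOfTwo : Prog := .loop 13 (.straight [.add 5 5 5, .sub 13 18 5])

/-- Draw the samples. -/
def drawSamples : Prog :=
  .loop 13 (.straight [.draw 9, .store 8 9, .add 8 8 2, .sub 13 13 2])

/-- The learner. -/
def prog : Prog :=
  .block [.straight [.const 2 1, .load 0 9, .load 1 2,
      .const 9 128, .mul 10 1 1, .mul 10 10 9, .mul 9 10 10, .mul 9 9 10, .const 10 80,
      .mul 3 9 10,
      .add 9 3 3, .add 9 9 2, .mul 9 9 1, .const 11 8, .mul 9 9 11, .mul 11 9 9, .mul 11 11 9,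
      .mul 4 11 10,
      .mul 18 0 1, .const 11 4, .mul 18 18 11, .const 5 1, .sub 13 18 5],
    powerOfTwo,
    .straight [.const 8 0, .copy 13 4],
    drawSamples,
    .straight [.const 6 0, .sub 13 0 6, .const 19 1],
    countBins,
    .straight [.emit 19, .const 6 0, .sub 13 0 6, .copy 15 5],
    emitBins,
    .straight [.emit 2, .emit 15]]

variable {ω : ℕ → ℕ} {B : ℕ}

/-- A sample `y ≥ a` contributes `max y (a + 1)` as its first breakpoint after `a`, and a sample `y
< a` contributes none. The program minimises these candidates together with `n`; maximum and minimum
are formed by truncated subtractions. -/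
theorem findNext_spec {σ : Config} {K n a : ℕ} (hω : ∀ i, ω i ≤ n)
    (hm : ∀ i < K, σ.mem i = ω i) (h0 : σ.reg 0 = n) (h2 : σ.reg 2 = 1) (h3 : σ.reg 3 = K)
    (h6 : σ.reg 6 = a) (ha : a < n) (hK : K ≤ B) (hn : n + 1 ≤ B) :
    Spec ω B findNext σ (11 * K + 3) fun τ =>
      IsLeast {v | a < v ∧ Breakpoint ω K n v} (τ.reg 7) ∧ τ.mem = σ.mem ∧ τ.out = σ.out ∧
      τ.drawn = σ.drawn ∧ ∀ r, r < 7 ∨ 11 < r → τ.reg r = σ.reg r := by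
  refine Spec.weaken (Spec.cons (Spec.straight (k := 2) ?_ (by simp [Op.units])))
    (k := 2 + (K * (10 + 1) + 1 + 0)) (by omega)
  simp [Op.Post, Op.Bounded, Op.step, Config.set_reg, h0, h3]
  refine ⟨by omega, hK, Spec.cons (k' := 0) ?_⟩
  refine Spec.loop (k := 10) (fun i τ => i ≤ K ∧ τ.reg 8 = i ∧ a < τ.reg 7 ∧ τ.reg 7 ≤ n ∧
    (τ.reg 7 = n ∨ ∃ k < K, τ.reg 7 = ω k ∨ τ.reg 7 = ω k + 1) ∧
    (∀ k, i ≤ k → k < K → a ≤ ω k → τ.reg 7 ≤ max (ω k) (a + 1)) ∧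
    τ.mem = σ.mem ∧ τ.out = σ.out ∧ τ.drawn = σ.drawn ∧
    ∀ r, r < 7 ∨ 11 < r → τ.reg r = σ.reg r) ?_ ?_ ?_ ?_
  · simp [Config.set_reg, ha]
    refine ⟨by omega, fun r hr => ?_⟩
    split_ifs <;> omega
  · rintro i τ h; omega
  · rintro i τ ⟨-, h8, h7, h7n, hB, hmin, h⟩ hz
    obtain rfl : i = 0 := by omega
    refine Spec.nil ⟨⟨⟨h7, hB⟩, ?_⟩, h⟩
    rintro v ⟨hv, rfl | ⟨k, hk, rfl | rfl⟩⟩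
    · exact h7n
    · have := hmin k (by omega) hk hv.le; omega
    · have := hmin k (by omega) hk (by omega); omega
  · rintro i τ ⟨hi, h8, h7, h7n, hB, hmin, hm', ho, hd, hf⟩ hz
    rcases i with _ | i
    · omega
    have f2 := hf 2 (by omega)
    have f6 := hf 6 (by omega)
    have hmi := hm i (by omega)
    have hωi := hω i
    refine ⟨i, by omega, Spec.weaken (Spec.cons (k := 4) (k' := 5 + 1) (Spec.straight ?_
      (by simp [Op.units]))) (by omega)⟩
    simp [Op.Post, Op.Bounded, Op.step, Config.set_reg, h8, f2, h2, hm', hmi, f6, h6]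
    and_intros
    any_goals omega
    refine Spec.weaken (Spec.cons (k := 1 + 5) (Spec.cond ?_ ?_ ?_)) (k := 6 + 0) (by omega)
    · simp [Config.set_reg]; omega
    · intro hc
      simp [Config.set_reg] at hc
      refine Spec.straight ?_ (by simp [Op.units])
      simp [Op.Post, Op.Bounded, Op.step, Config.set_reg, f2, h2, f6, h6]
      and_intros
      any_goals omega
      refine Spec.nil ?_
      simp [Config.set_reg, hm', ho, hd]
      and_intros
      any_goals omega
      · by_cases h : τ.reg 7 ≤ max (ω i) (a + 1)
        · rw [show τ.reg 7 - (τ.reg 7 - (ω i + (a + 1 - ω i))) = τ.reg 7 by omega]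
          exact hB
        · exact .inr ⟨i, by omega, by omega⟩
      · intro k hk1 hk2 hk3
        rcases hk1.eq_or_lt with rfl | hk1
        · omega
        · have := hmin k hk1 hk2 hk3; omega
      · intro r hr
        rw [← hf r hr]
        split_ifs <;> omega
    · intro hc
      simp [Config.set_reg] at hc
      refine Spec.straight ?_ (by simp)
      refine Spec.nil ?_
      simp [Config.set_reg, hm', ho, hd, h7, h7n, hB]
      and_intros
      any_goals omega
      · intro k hk1 hk2 hk3
        rcases hk1.eq_or_lt with rfl | hk1
        · omega
        · have := hmin k hk1 hk2 hk3; omega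
      · intro r hr
        rw [← hf r hr]
        split_ifs <;> omega

theorem countSamples_spec {σ : Config} {M n a b : ℕ} (hω : ∀ i, ω i ≤ n)
    (hm : ∀ i < M, σ.mem i = ω i) (h2 : σ.reg 2 = 1) (h4 : σ.reg 4 = M)
    (h6 : σ.reg 6 = a) (h7 : σ.reg 7 = b) (ha : a ≤ n) (hb : b ≤ n) (hM : M ≤ B)
    (hn : 2 * n + 2 ≤ B) :
    Spec ω B countSamples σ (9 * M + 3) fun τ =>
      τ.reg 12 = sampleCount ω M a b ∧ τ.mem = σ.mem ∧ τ.out = σ.out ∧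
      τ.drawn = σ.drawn ∧ ∀ r, r < 8 ∨ 12 < r → τ.reg r = σ.reg r := by
  refine Spec.weaken (Spec.cons (Spec.straight (k := 2) ?_ (by simp [Op.units])))
    (k := 2 + (M * (8 + 1) + 1 + 0)) (by omega)
  simp [Op.Post, Op.Bounded, Op.step, Config.set_reg, h4]
  refine ⟨hM, Spec.cons (k' := 0) ?_⟩
  refine Spec.loop (k := 8) (fun i τ => i ≤ M ∧ τ.reg 8 = i ∧
    τ.reg 12 + sampleCount ω i a b = sampleCount ω M a b ∧
    τ.mem = σ.mem ∧ τ.out = σ.out ∧ τ.drawn = σ.drawn ∧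
    ∀ r, r < 8 ∨ 12 < r → τ.reg r = σ.reg r) ?_ ?_ ?_ ?_
  · simp [Config.set_reg]
    intro r hr
    split_ifs <;> omega
  · rintro i τ h; omega
  · rintro i τ ⟨-, h8, hc, h⟩ hz
    obtain rfl : i = 0 := by omega
    exact Spec.nil ⟨by simpa [sampleCount] using hc, h⟩
  · rintro i τ ⟨hi, h8, hc, hm', ho, hd, hf⟩ hz
    rcases i with _ | i
    · omega
    have f2 := hf 2 (by omega)
    have f6 := hf 6 (by omega)
    have f7 := hf 7 (by omega)
    have hmi := hm i (by omega)
    have hωi := hω i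
    have hcM := sampleCount_le ω M a b
    -- `1 - ((a - y) + (y + 1 - b))`, truncated, is the indicator of `a ≤ y < b`.
    have hs : sampleCount ω (i + 1) a b =
        sampleCount ω i a b + (1 - (a - ω i + (ω i + 1 - b))) := by
      simp only [sampleCount, Finset.range_add_one, Finset.filter_insert]
      split_ifs with h
      · rw [Finset.card_insert_of_notMem (by simp)]; omega
      · omega
    refine ⟨i, by omega, Spec.straight ?_ (by simp [Op.units])⟩
    simp [Op.Post, Op.Bounded, Op.step, Config.set_reg, h8, f2, h2, hm', hmi, f6, h6, f7, h7]
    and_intros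
    any_goals omega
    · intro r hr
      rw [← hf r hr]
      split_ifs <;> omega

end Learner

/-! ### Correctness of the passes over the bins and of the sample storage -/

namespace Learner

/-- The list of numbers that represents a list of bins. -/
def flat (bs : List (ℕ × ℕ)) : List ℕ := bs.flatMap fun b => [b.1, b.2]

variable {ω : ℕ → ℕ} {B K M R n : ℕ}

/-- An encoding begins with the number of bins and output can only be appended, so the bins are
traversed once merely to be counted. Register `19` starts at `1` for the last bin `{n}`. -/
theorem countBins_spec {σ : Config} {r : ℕ} {bs : List (ℕ × ℕ)} (hω : ∀ i, ω i ≤ n)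
    (hm : ∀ i < K, σ.mem i = ω i) (h0 : σ.reg 0 = n) (h2 : σ.reg 2 = 1) (h3 : σ.reg 3 = K)
    (h6 : σ.reg 6 = 0) (h13 : σ.reg 13 = n) (h19 : σ.reg 19 = 1)
    (hbs : Binned ω K M R n 0 r bs) (hK : 2 * K + 2 ≤ B) (hn : n + 1 ≤ B) :
    Spec ω B countBins σ (bs.length * (11 * K + 7) + 1) fun τ =>
      τ.reg 19 = bs.length ∧ τ.mem = σ.mem ∧ τ.out = σ.out ∧
      τ.drawn = σ.drawn ∧ ∀ r, r < 6 ∨ 13 < r ∧ r < 19 → τ.reg r = σ.reg r := by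
  have hlen := hbs.length_le
  refine Spec.loop (k := 11 * K + 6) (fun i τ => ∃ r cs, Binned ω K M R n (τ.reg 6) r cs ∧
    i = cs.length ∧ τ.reg 13 = n - τ.reg 6 ∧ τ.reg 19 + cs.length = bs.length + 1 ∧
    τ.mem = σ.mem ∧ τ.out = σ.out ∧ τ.drawn = σ.drawn ∧
    ∀ r, r < 6 ∨ 13 < r ∧ r < 19 → τ.reg r = σ.reg r) ?_ ?_ ?_ ?_
  · exact ⟨r, bs, by rwa [h6], rfl, by omega, by omega, rfl, rfl, rfl, fun _ _ => rfl⟩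
  · rintro i τ ⟨r, cs, -, -, h, -⟩
    omega
  · rintro i τ ⟨r, cs, hb, -, h13, h19, h⟩ hz
    have hle := hb.le
    refine ⟨?_, h⟩
    generalize he : τ.reg 6 = a at *
    cases hb with
    | last => simpa using h19
    | step ha => omega
  · rintro i τ ⟨r, cs, hb, rfl, h13, h19, hm', ho, hd, hf⟩ hz
    have f0 := hf 0 (by omega)
    have f2 := hf 2 (by omega)
    have f3 := hf 3 (by omega)
    have hlt : τ.reg 6 < n := by omega
    generalize hc : τ.reg 6 = a at *
    cases hb with
    | last => omega
    | @step _ b _ cs ha hb hcs =>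
      refine ⟨cs.length, by simp, ?_⟩
      have hbn := hcs.le
      simp only [List.length_cons] at h19
      have hcl := hcs.length_pos
      refine Spec.weaken (Spec.cons ((findNext_spec (K := K) hω (by simpa [hm'] using hm) (f0.trans h0)
        (f2.trans h2) (f3.trans h3) hc ha (by omega) hn).mono le_rfl ?_))
        (k := 11 * K + 3 + (3 + 0)) (by omega)
      rintro υ ⟨g7, gm, go, gd, gf⟩
      have g0 := gf 0 (by omega)
      have g2 := gf 2 (by omega)
      have g19 := gf 19 (by omega)
      -- Least elements are unique, so the breakpoint found by the program is the one in the
      -- relation `Binned`.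
      have e7 := g7.unique hb
      refine Spec.cons (Spec.straight ?_ (by simp [Op.units]))
      simp [Op.Post, Op.Bounded, Op.step, Config.set_reg, g0, f0, h0, e7, g2, f2, h2, g19]
      and_intros
      any_goals omega
      refine Spec.nil ⟨r - binWeight ω M R a b, cs, ?_, rfl, ?_⟩
      · simpa [Config.set_reg] using hcs
      · simp [Config.set_reg, gm, hm', go, ho, gd, hd]
        refine ⟨by omega, fun r hr => ?_⟩
        rw [← hf r (by omega), ← gf r (by omega)]
        split_ifs <;> omega

/-- The conserved quantity is the output so far followed by the encoding of the bins still to come.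
At the end only the bin `{n}` is left, with the remaining weight in register `15`. -/
theorem emitBins_spec {σ : Config} {r : ℕ} {bs : List (ℕ × ℕ)} (hω : ∀ i, ω i ≤ n)
    (hm : ∀ i < M, σ.mem i = ω i) (h0 : σ.reg 0 = n) (h2 : σ.reg 2 = 1) (h3 : σ.reg 3 = K)
    (h4 : σ.reg 4 = M) (h5 : σ.reg 5 = R)
    (h6 : σ.reg 6 = 0) (h13 : σ.reg 13 = n) (h15 : σ.reg 15 = r)
    (hbs : Binned ω K M R n 0 r bs) (hKM : K ≤ M) (hM : 0 < M) (hn : 2 * n + 2 ≤ B)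
    (hMn : M * n ≤ B) (hMR : M * R ≤ B) (hr : r ≤ B) :
    Spec ω B emitBins σ (bs.length * (11 * K + 9 * M + 16 + 4 * B.size + 1) + 1) fun τ =>
      τ.out ++ [1, τ.reg 15] = σ.out ++ flat bs ∧ τ.reg 15 ≤ r ∧ τ.reg 2 = 1 ∧
      τ.drawn = σ.drawn := by
  refine Spec.loop (k := 11 * K + 9 * M + 16 + 4 * B.size) (fun i τ => ∃ cs,
    Binned ω K M R n (τ.reg 6) (τ.reg 15) cs ∧
    i = cs.length ∧ τ.reg 13 = n - τ.reg 6 ∧ τ.out ++ flat cs = σ.out ++ flat bs ∧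
    τ.reg 15 ≤ r ∧ τ.mem = σ.mem ∧ τ.drawn = σ.drawn ∧
    ∀ r, r < 6 → τ.reg r = σ.reg r) ?_ ?_ ?_ ?_
  · exact ⟨bs, by rwa [h6, h15], rfl, by omega, rfl, by omega, rfl, rfl, fun _ _ => rfl⟩
  · rintro i τ ⟨cs, -, -, h, -⟩
    omega
  · rintro i τ ⟨cs, hb, -, h13, ho, h15, hm', hd, hf⟩ hz
    have hle := hb.le
    refine ⟨?_, h15, (hf 2 (by omega)).trans h2, hd⟩
    rw [← ho]
    generalize he : τ.reg 6 = a at *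
    generalize he : τ.reg 15 = r' at *
    cases hb with
    | last => simp [flat]
    | step ha => omega
  · rintro i τ ⟨cs, hb, rfl, h13, ho, h15, hm', hd, hf⟩ hz
    have f0 := hf 0 (by omega)
    have f2 := hf 2 (by omega)
    have f3 := hf 3 (by omega)
    have f4 := hf 4 (by omega)
    have f5 := hf 5 (by omega)
    have hlt : τ.reg 6 < n := by omega
    have hMM : M ≤ M * n := Nat.le_mul_of_pos_right _ (by omega)
    generalize hc : τ.reg 6 = a at *
    generalize hr' : τ.reg 15 = r' at *
    cases hb with
    | last => omega
    | @step _ b _ cs ha hb hcs =>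
      refine ⟨cs.length, by simp, ?_⟩
      have hbn := hcs.le
      have hab := hb.1.1
      have hwt : binWeight ω M R a b ≤ M * R :=
        (Nat.le_mul_of_pos_left _ hM).trans ((mul_binWeight_le ω M R a b).trans
          (Nat.mul_le_mul_right _ (sampleCount_le ω M a b)))
      have hcR : sampleCount ω M a b * R ≤ M * R := Nat.mul_le_mul_right _ (sampleCount_le ω M a b)
      have hRR : R ≤ M * R := Nat.le_mul_of_pos_left _ hM
      have hMl : M * (b - a) ≤ M * n := Nat.mul_le_mul_left _ (by omega)
      have hq : sampleCount ω M a b * R / (M * (b - a)) ≤ sampleCount ω M a b * R :=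
        Nat.div_le_self _ _
      have hcM := sampleCount_le ω M a b
      refine Spec.weaken (Spec.cons ((findNext_spec (K := K) hω
        (fun i hi => by rw [hm', hm i (by omega)]) (f0.trans h0)
        (f2.trans h2) (f3.trans h3) hc ha (by omega) (by omega)).mono le_rfl ?_))
        (k := 11 * K + 3 + (9 * M + 3 + (10 + 4 * B.size + 0))) (by omega)
      rintro υ ⟨g7, gm, go, gd, gf⟩
      have e7 := g7.unique hb
      refine Spec.cons ((countSamples_spec (M := M) (a := a) (b := b) hω
        (fun i hi => by rw [gm, hm', hm i hi])
        (by rw [gf 2 (by omega), f2, h2]) (by rw [gf 4 (by omega), f4, h4])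
        (by rw [gf 6 (by omega), hc]) e7 ha.le hbn (by omega) (by omega)).mono le_rfl ?_)
      rintro π ⟨p12, pm, po, pd, pf⟩
      have p0 : π.reg 0 = n := by rw [pf 0 (by omega), gf 0 (by omega), f0, h0]
      have p4 : π.reg 4 = M := by rw [pf 4 (by omega), gf 4 (by omega), f4, h4]
      have p5 : π.reg 5 = R := by rw [pf 5 (by omega), gf 5 (by omega), f5, h5]
      have p6 : π.reg 6 = a := by rw [pf 6 (by omega), gf 6 (by omega), hc]
      have p7 : π.reg 7 = b := by rw [pf 7 (by omega), e7]
      have p15 : π.reg 15 = r' := by rw [pf 15 (by omega), gf 15 (by omega), hr']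
      refine Spec.cons (Spec.straight ?_ (by simp [Op.units]; omega))
      simp [Op.Post, Op.Bounded, Op.step, Config.set_reg, p0, p4, p5, p6, p7, p12, p15]
      rw [← binWeight]
      and_intros
      any_goals omega
      refine Spec.nil ⟨cs, ?_, rfl, ?_⟩
      · simpa [Config.set_reg] using hcs
      · simp [Config.set_reg, pm, gm, hm', po, go, pd, gd, hd]
        refine ⟨by simpa [flat] using ho, by omega, fun r hr => ?_⟩
        rw [← hf r (by omega), ← gf r (by omega), ← pf r (by omega)]
        split_ifs <;> omega

/-- Doubling from `1` until `T` is reached takes `Nat.clog 2 T` steps, the only loop of the learner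
whose length depends on `n`. -/
theorem powerOfTwo_spec {σ : Config} {T : ℕ} (h5 : σ.reg 5 = 1) (h18 : σ.reg 18 = T)
    (h13 : σ.reg 13 = T - 1) (hT : 0 < T) (hB : 2 * T ≤ B) :
    Spec ω B powerOfTwo σ (Nat.clog 2 T * 3 + 1) fun τ => τ.reg 5 = 2 ^ Nat.clog 2 T ∧
      τ.mem = σ.mem ∧ τ.out = σ.out ∧ τ.drawn = σ.drawn ∧ ∀ r < 5, τ.reg r = σ.reg r := by
  refine Spec.loop (k := 2) (fun i τ => ∃ j, i + j = Nat.clog 2 T ∧ τ.reg 5 = 2 ^ j ∧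
    τ.reg 18 = T ∧ τ.reg 13 = T - 2 ^ j ∧
    τ.mem = σ.mem ∧ τ.out = σ.out ∧ τ.drawn = σ.drawn ∧ ∀ r < 5, τ.reg r = σ.reg r) ?_ ?_ ?_ ?_
  · exact ⟨0, by simp, by simpa using h5, h18, by simpa using h13, rfl, rfl, rfl, fun _ _ => rfl⟩
  · rintro i τ ⟨j, h⟩; omega
  · rintro i τ ⟨j, hij, h5', h18', h13', h⟩ hz
    have h1 : Nat.clog 2 T ≤ j := Nat.clog_le_of_le_pow (by omega)
    obtain rfl : j = Nat.clog 2 T := by omega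
    exact ⟨h5', h⟩
  · rintro i τ ⟨j, hij, h5', h18', h13', hm, ho, hd, hf⟩ hz
    have h1 : j < Nat.clog 2 T := by
      by_contra h
      have := (Nat.clog_le_iff_le_pow (b := 2) (by norm_num) (x := T) (y := j)).1 (by omega)
      omega
    rcases i with _ | i
    · omega
    refine ⟨i, by omega, Spec.straight ?_ (by simp [Op.units])⟩
    simp [Op.Post, Op.Bounded, Op.step, Config.set_reg, h5', h18', hm, ho, hd]
    rw [← two_mul, ← pow_succ']
    refine ⟨by omega, by omega, j + 1, by omega, rfl, rfl, ?_⟩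
    intro r hr
    rw [← hf r hr]
    split_ifs <;> omega

theorem drawSamples_spec {σ : Config} (hω : ∀ i, ω i ≤ n) (h2 : σ.reg 2 = 1) (h8 : σ.reg 8 = 0)
    (h13 : σ.reg 13 = M) (hd : σ.drawn = 0) (hM : M ≤ B) (hn : n ≤ B) (hB : 1 ≤ B) :
    Spec ω B drawSamples σ (M * 5 + 1) fun τ => (∀ i < M, τ.mem i = ω i) ∧ τ.drawn = M ∧
      τ.out = σ.out ∧ ∀ r < 8, τ.reg r = σ.reg r := by
  refine Spec.loop (k := 4) (fun i τ => ∃ j, i + j = M ∧ (∀ i < j, τ.mem i = ω i) ∧ τ.drawn = j ∧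
    τ.reg 8 = j ∧ τ.reg 13 = i ∧ τ.out = σ.out ∧ ∀ r < 8, τ.reg r = σ.reg r) ?_ ?_ ?_ ?_
  · exact ⟨0, by simp, by simp, hd, h8, h13, rfl, fun _ _ => rfl⟩
  · rintro i τ ⟨j, h⟩; omega
  · rintro i τ ⟨j, hij, hm, hd, h8', h13', h⟩ hz
    obtain rfl : j = M := by omega
    exact ⟨hm, hd, h⟩
  · rintro i τ ⟨j, hij, hm, hd, h8', h13', ho, hf⟩ hz
    rcases i with _ | i
    · omega
    have f2 := (hf 2 (by omega)).trans h2
    have hωj := hω j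
    refine ⟨i, by omega, Spec.straight ?_ (by simp [Op.units])⟩
    simp [Op.Post, Op.Bounded, Op.step, Config.set_reg, hd, h8', h13', f2, ho]
    and_intros
    any_goals omega
    · intro k hk
      rw [Function.update_apply]
      split_ifs with h
      · rw [h]
      · exact hm k (by omega)
    · intro r hr
      rw [← hf r hr]
      split_ifs <;> omega

end Learner

/-! ### The parameters and the complete learner -/

namespace Learner

/-- The first batch of samples determines the distribution function up to `1 / firstScale E`. -/
def firstScale (E : ℕ) : ℕ := E * E * 128

/-- The number of samples that define breakpoints. -/
def firstCount (E : ℕ) : ℕ := firstScale E * firstScale E * firstScale E * 80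

/-- All samples determine the distribution function up to `1 / secondScale E`. -/
def secondScale (E : ℕ) : ℕ := (firstCount E + firstCount E + 1) * E * 8

/-- The number of samples. -/
def secondCount (E : ℕ) : ℕ := secondScale E * secondScale E * secondScale E * 80

/-- The binary logarithm of the total weight. -/
def weightLog (n E : ℕ) : ℕ := Nat.clog 2 (n * E * 4)

/-- A bound on all numbers that occur in the computations. -/
def numberBound (n E : ℕ) : ℕ := 16 * n * E * secondCount E

variable {n E : ℕ}

theorem firstScale_le (hE : 1 ≤ E) : 128 ≤ firstScale E := by
  have : 1 ≤ E * E := Nat.mul_pos hE hE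
  rw [firstScale]; omega

theorem firstScale_le_firstCount (hE : 1 ≤ E) : firstScale E ≤ firstCount E := by
  have h := firstScale_le hE
  rw [firstCount, mul_assoc, mul_assoc]
  exact Nat.le_mul_of_pos_right _ (by positivity)

theorem firstCount_le_secondScale (hE : 1 ≤ E) :
    8 * (2 * firstCount E + 1) ≤ secondScale E := by
  rw [secondScale]
  have := Nat.le_mul_of_pos_right (firstCount E + firstCount E + 1) hE
  omega

theorem secondScale_cube_le (hE : 1 ≤ E) :
    secondScale E ≤ secondScale E * secondScale E ∧
    secondScale E * secondScale E ≤ secondScale E * secondScale E * secondScale E ∧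
    secondScale E * secondScale E * secondScale E * 80 = secondCount E := by
  have := firstCount_le_secondScale hE
  have h : 0 < secondScale E := by omega
  exact ⟨Nat.le_mul_of_pos_right _ h, Nat.le_mul_of_pos_right _ h, rfl⟩

theorem weight_bounds (hn : 1 ≤ n) (hE : 1 ≤ E) :
    n * E * 4 ≤ 2 ^ weightLog n E ∧ 2 ^ weightLog n E ≤ 2 * (n * E * 4) := by
  have h0 : 0 < n * E := Nat.mul_pos hn hE
  refine ⟨(Nat.clog_le_iff_le_pow (by norm_num)).1 le_rfl, ?_⟩
  rw [weightLog]
  have h1 := Nat.clog_pos (b := 2) (n := n * E * 4) (by norm_num) (by omega)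
  obtain ⟨k, hk⟩ : ∃ k, Nat.clog 2 (n * E * 4) = k + 1 := ⟨_, (Nat.sub_add_cancel h1).symm⟩
  have h2 : 2 ^ k < n * E * 4 := by
    by_contra h
    have := Nat.clog_le_of_le_pow (b := 2) (not_lt.1 h)
    omega
  rw [hk, pow_succ]
  omega

/-- The critical numbers are the products `M * (b - a)` and `count * R` formed for a weight, where
`R ≤ 8nE`; the bound `16nEM` covers both. -/
theorem numberBound_bounds (hn : 1 ≤ n) (hE : 1 ≤ E) :
    secondCount E * n ≤ numberBound n E ∧
    secondCount E * 2 ^ weightLog n E ≤ numberBound n E ∧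
    secondCount E ≤ secondCount E * n ∧
    2 ^ weightLog n E ≤ secondCount E * 2 ^ weightLog n E ∧ 2 * (n * E * 4) ≤ numberBound n E ∧
    n * 4 ≤ n * E * 4 ∧ E * 4 ≤ n * E * 4 ∧ 40960 ≤ secondCount E := by
  have h1 := secondScale_cube_le hE
  have h2 := firstCount_le_secondScale hE
  have h0 : 0 < secondCount E := by omega
  have h3 : secondScale E * 8 ≤ secondScale E * secondScale E := by gcongr; omega
  have h4 : secondScale E * secondScale E * 8 ≤ secondScale E * secondScale E * secondScale E := by
    gcongr; omega
  refine ⟨?_, ?_, Nat.le_mul_of_pos_right _ hn, Nat.le_mul_of_pos_left _ h0, ?_, ?_, ?_, by omega⟩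
  · calc secondCount E * n = n * 1 * secondCount E := by ring
      _ ≤ (16 * n) * E * secondCount E := by gcongr; omega
  · calc secondCount E * 2 ^ weightLog n E ≤ secondCount E * (2 * (n * E * 4)) := by
          gcongr; exact (weight_bounds hn hE).2
      _ = 8 * n * E * secondCount E := by ring
      _ ≤ 16 * n * E * secondCount E := by gcongr; omega
  · calc 2 * (n * E * 4) = 8 * n * E * 1 := by ring
      _ ≤ 16 * n * E * secondCount E := by gcongr <;> omega
  · calc n * 4 = n * 1 * 4 := by ring
      _ ≤ n * E * 4 := by gcongr
  · calc E * 4 = 1 * E * 4 := by ring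
      _ ≤ n * E * 4 := by gcongr

theorem firstCount_le (hE : 1 ≤ E) : firstCount E ≤ secondCount E := by
  have := secondScale_cube_le hE
  have := firstCount_le_secondScale hE
  omega

/-- The left side is the sum of the costs of the blocks of the learner, in their order. It is
quadratic in `M` because each of the at most `2 * K + 2` bins needs passes over the samples; `s`
enters through multiplications, divisions and the doublings. -/
theorem cost_le {K M L s t : ℕ} (hK : 2 * K + 2 ≤ M) (hL : L ≤ 2 * K + 2) (ht : t ≤ s)
    (hM : 40 ≤ M) :
    (23 + 13 * s) + ((t * 3 + 1) + (2 + ((M * 5 + 1) + (3 +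
      ((L * (11 * K + 7) + 1) + (4 + ((L * (11 * K + 9 * M + 16 + 4 * s + 1) + 1)
       + (2 + 0)))))))) ≤ 100 * M * M * (1 + s) := by
  have h1 : L * (11 * K + 7) ≤ M * (12 * M) := Nat.mul_le_mul (by omega) (by omega)
  have h2 : L * (11 * K + 9 * M + 16 + 4 * s + 1) ≤ M * (21 * M + 4 * s) :=
    Nat.mul_le_mul (by omega) (by omega)
  have h3 : M ≤ M * M := Nat.le_mul_of_pos_right _ (by omega)
  have h4 : s ≤ M * s := Nat.le_mul_of_pos_left _ (by omega)
  have h5 : M * s ≤ M * M * s := by gcongr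
  nlinarith

theorem prog_spec {ω : ℕ → ℕ} {bs : List (ℕ × ℕ)} (hn : 1 ≤ n) (hE : 1 ≤ E) (hω : ∀ i, ω i ≤ n)
    (hbs : Binned ω (firstCount E) (secondCount E) (2 ^ weightLog n E) n 0 (2 ^ weightLog n E) bs) :
    Spec ω (numberBound n E) prog ⟨fun _ => 0, fun i => [n, E].getD i 0, [], 0⟩
      (100 * secondCount E * secondCount E * (1 + (numberBound n E).size)) fun τ =>
        τ.out = Histogram.encode ⟨bs⟩ ∧ τ.drawn = secondCount E := by
  have b1 := firstScale_le hE
  have b2 := firstScale_le_firstCount hE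
  have b3 := firstCount_le_secondScale hE
  have b4 := secondScale_cube_le hE
  have b5 := weight_bounds hn hE
  have b6 := numberBound_bounds hn hE
  have b7 := firstCount_le hE
  have b8 := hbs.length_le
  have b9 : firstScale E ≤ firstScale E * firstScale E := Nat.le_mul_of_pos_right _ (by omega)
  have b10 : firstScale E * firstScale E ≤ firstScale E * firstScale E * firstScale E :=
    Nat.le_mul_of_pos_right _ (by omega)
  have b11 : firstScale E * firstScale E * firstScale E * 80 = firstCount E := rfl
  have b12 : firstCount E + firstCount E + 1 ≤ (firstCount E + firstCount E + 1) * E :=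
    Nat.le_mul_of_pos_right _ hE
  have b13 : (firstCount E + firstCount E + 1) * E * 8 = secondScale E := rfl
  have b14 : E * E * 128 = firstScale E := rfl
  have b15 : Nat.clog 2 (n * E * 4) = weightLog n E := rfl
  have hlog : weightLog n E ≤ (numberBound n E).size := by
    have := Nat.size_le_size (m := 2 ^ weightLog n E) (n := numberBound n E) (by omega)
    rw [Nat.size_pow] at this
    omega
  generalize numberBound n E = B at *
  generalize secondCount E = M at *
  generalize firstCount E = K at *
  generalize weightLog n E = t at *
  generalize hR : 2 ^ t = R at *
  refine Spec.weaken ?_ (cost_le (K := K) (L := bs.length) (t := t) (by omega) b8 hlog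
    (by omega))
  refine Spec.cons (Spec.straight ?_ (by clear * -; simp [Op.units]; omega))
  simp [Op.Post, Op.Bounded, Op.step, Config.set_reg, b14, b11, b13, b4.2.2]
  and_intros
  any_goals omega
  refine Spec.cons ((powerOfTwo_spec (T := n * E * 4) ?_ ?_ ?_ ?_ ?_).mono (by rw [b15])
    ?_)
  · simp [Config.set_reg]
  · simp [Config.set_reg]
  · simp [Config.set_reg]
  · omega
  · omega
  rintro τ₁ ⟨a5, -, ao, ad, af⟩
  rw [b15, hR] at a5
  have a0 := af 0 (by omega)
  have a2 := af 2 (by omega)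
  have a3 := af 3 (by omega)
  have a4 := af 4 (by omega)
  simp [Config.set_reg] at a0 a2 a3 a4 ao ad
  refine Spec.cons (Spec.straight ?_ (by simp [Op.units]))
  simp [Op.Post, Op.Bounded, Op.step, Config.set_reg, a4]
  and_intros
  any_goals omega
  refine Spec.cons ((drawSamples_spec (M := M) hω ?_ ?_ ?_ ?_ ?_ ?_ ?_).mono le_rfl ?_)
  · simp [Config.set_reg, a2]
  · simp [Config.set_reg]
  · simp [Config.set_reg]
  · simp [ad]
  any_goals omega
  rintro τ₂ ⟨dm, dd, do', df⟩
  have d0 := df 0 (by omega)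
  have d2 := df 2 (by omega)
  have d3 := df 3 (by omega)
  have d4 := df 4 (by omega)
  have d5 := df 5 (by omega)
  simp [Config.set_reg, a0, a2, a3, a4, a5, ao] at d0 d2 d3 d4 d5 do'
  refine Spec.cons (Spec.straight ?_ (by simp [Op.units]))
  simp [Op.Post, Op.Bounded, Op.step, Config.set_reg, d0]
  and_intros
  any_goals omega
  refine Spec.cons ((countBins_spec (K := K) hω ?_ ?_ ?_ ?_ ?_ ?_ ?_ hbs ?_ ?_).mono le_rfl ?_)
  · exact fun i hi => dm i (by omega)
  any_goals (simp [Config.set_reg, d0, d2, d3])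
  any_goals omega
  intro τ₃ c19 cm co cd cf
  have c0 := cf 0 (by omega)
  have c2 := cf 2 (by omega)
  have c3 := cf 3 (by omega)
  have c4 := cf 4 (by omega)
  have c5 := cf 5 (by omega)
  simp [d0, d2, d3, d4, d5, do', dd] at c0 c2 c3 c4 c5 co cd
  refine Spec.cons (Spec.straight ?_ (by simp [Op.units]))
  simp [Op.Post, Op.Bounded, Op.step, Config.set_reg, c0, c5, c19]
  and_intros
  any_goals omega
  refine Spec.cons ((emitBins_spec (K := K) (M := M) (R := R) hω ?_ ?_ ?_ ?_ ?_ ?_ ?_ ?_ ?_ hbs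
    ?_ ?_ ?_ ?_ ?_ ?_).mono le_rfl ?_)
  · exact fun i hi => by simp [cm, dm i hi]
  any_goals (simp [Config.set_reg, c0, c2, c3, c4, c5])
  any_goals omega
  intro τ₄ eo er e2 ed
  refine Spec.cons (k := 2) (k' := 0) (Spec.straight ?_ (by simp [Op.units]))
  simp [Op.Post, Op.Bounded, Op.step, e2]
  and_intros
  any_goals omega
  simp only [co, cd] at eo ed
  refine Spec.nil ⟨?_, ed⟩
  simp [eo, Histogram.encode, flat]

end Learner

/-! ### Sums of independent Bernoulli variables are log-concave -/

/-- The generating polynomial of a sum of independent Bernoulli variables. -/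
noncomputable def bernoulliPoly {n : ℕ} (p : Fin n → unitInterval) (s : Finset (Fin n)) :
    Polynomial ℝ :=
  ∏ i ∈ s, (Polynomial.C (1 - (p i : ℝ)) + Polynomial.C (p i : ℝ) * Polynomial.X)

theorem productBits_real_singleton {n : ℕ} (p : Fin n → unitInterval) (x : Fin n → Bool) :
    (productBits p).real {x} = ∏ i, if x i then (p i : ℝ) else 1 - p i := by
  rw [productBits, measureReal_def, Measure.pi_singleton, ENNReal.toReal_prod]
  refine Finset.prod_congr rfl fun i _ => ?_
  rw [← measureReal_def, bernoulliMeasure_real_apply _ (measurableSet_singleton _)]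
  cases x i <;> simp

/-- Expanding the product of the factors `(1 - p i) + p i * X` gives one monomial per bit vector,
with its probability as coefficient and its bit sum as exponent. -/
theorem sumOfBernoullis_real_singleton {n : ℕ} (p : Fin n → unitInterval) (j : ℕ) :
    (sumOfBernoullis p).real {j} = (bernoulliPoly p Finset.univ).coeff j := by
  have h1 : bernoulliPoly p Finset.univ = ∑ x : Fin n → Bool,
      Polynomial.C (∏ i, if x i then (p i : ℝ) else 1 - p i) * Polynomial.X ^ bitSum x := by
    have h2 : ∀ i, Polynomial.C (1 - (p i : ℝ)) + Polynomial.C (p i : ℝ) * Polynomial.X =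
        ∑ b : Bool, Polynomial.C (if b then (p i : ℝ) else 1 - p i) *
          Polynomial.X ^ b.toNat := fun i => by simp [add_comm]
    rw [bernoulliPoly, Finset.prod_congr rfl fun i _ => h2 i, Finset.prod_univ_sum]
    refine Finset.sum_congr (by ext; simp) fun x _ => ?_
    rw [Finset.prod_mul_distrib, Finset.prod_pow_eq_pow_sum, bitSum, map_prod]
  rw [sumOfBernoullis, map_measureReal_apply (measurable_of_countable _)
    (measurableSet_singleton _), h1, Polynomial.finsetSum_coeff]
  have h3 : (bitSum ⁻¹' {j} : Set (Fin n → Bool)) =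
      ((Finset.univ.filter fun x => bitSum x = j : Finset (Fin n → Bool)) : Set _) := by
    ext x; simp
  rw [h3, ← sum_measureReal_singleton, Finset.sum_filter]
  refine Finset.sum_congr rfl fun x _ => ?_
  rw [Polynomial.coeff_C_mul_X_pow, productBits_real_singleton]
  simp only [eq_comm]

/-- The coefficients of a polynomial, with zeros at the negative integers. -/
noncomputable def Polynomial.intCoeff (P : Polynomial ℝ) (z : ℤ) : ℝ :=
  if 0 ≤ z then P.coeff z.toNat else 0

theorem Polynomial.intCoeff_linear_mul (P : Polynomial ℝ) (q p : ℝ) (z : ℤ) :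
    ((C q + C p * X) * P).intCoeff z = q * P.intCoeff z + p * P.intCoeff (z - 1) := by
  unfold intCoeff
  rcases lt_trichotomy z 0 with h | rfl | h
  · rw [if_neg (by omega), if_neg (by omega), if_neg (by omega)]; simp
  · simp [mul_coeff_zero]
  · obtain ⟨k, rfl⟩ : ∃ k : ℕ, z = k + 1 := ⟨(z - 1).toNat, by omega⟩
    rw [if_pos (by omega), if_pos (by omega), if_pos (by omega)]
    rw [show ((k : ℤ) + 1).toNat = k + 1 by omega, show ((k : ℤ) + 1 - 1).toNat = k by omega,
      add_mul, coeff_add, mul_assoc, coeff_C_mul, coeff_C_mul, coeff_X_mul]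

/-- A nonnegative function on the integers is log-concave without internal zeros. -/
def LogConcave (f : ℤ → ℝ) : Prop :=
  (∀ z, 0 ≤ f z) ∧ ∀ i j k, i ≤ j → 0 ≤ k → f i * f (j + k) ≤ f j * f (i + k)

/-- After expansion the `q ^ 2` and `p ^ 2` terms are instances of the hypothesis. The two cross
terms are compared in pairs, by the instances `(i, j, k - 1)` and `(i - 1, j - 1, k + 1)`. Indexing
by the integers spares a boundary case at `0`. -/
theorem LogConcave.convolve {f : ℤ → ℝ} (hf : LogConcave f) {q p : ℝ} (hq : 0 ≤ q) (hp : 0 ≤ p) :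
    LogConcave fun z => q * f z + p * f (z - 1) := by
  obtain ⟨h0, h⟩ := hf
  refine ⟨fun z => add_nonneg (mul_nonneg hq (h0 _)) (mul_nonneg hp (h0 _)), ?_⟩
  intro i j k hij hk
  rcases hij.eq_or_lt with rfl | hij'
  · rfl
  rcases hk.eq_or_lt with rfl | hk'
  · simp [mul_comm]
  have h1 := h i j k hij hk
  have h2 := h (i - 1) (j - 1) k (by omega) hk
  have h3 := h i j (k - 1) hij (by omega)
  have h4 := h (i - 1) (j - 1) (k + 1) (by omega) (by omega)
  rw [show j - 1 + k = j + k - 1 by ring, show i - 1 + k = i + k - 1 by ring] at h2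
  rw [← add_sub_assoc, ← add_sub_assoc] at h3
  rw [show j - 1 + (k + 1) = j + k by ring, show i - 1 + (k + 1) = i + k by ring] at h4
  have e1 := mul_le_mul_of_nonneg_left h1 (mul_nonneg hq hq)
  have e2 := mul_le_mul_of_nonneg_left h2 (mul_nonneg hp hp)
  have e3 := mul_le_mul_of_nonneg_left (add_le_add h3 h4) (mul_nonneg hq hp)
  dsimp only
  linarith

/-- Induction on the factors, starting from the point mass at `0`. -/
theorem logConcave_bernoulliPoly {n : ℕ} (p : Fin n → unitInterval) (s : Finset (Fin n)) :
    LogConcave (bernoulliPoly p s).intCoeff := by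
  classical
  induction s using Finset.induction_on with
  | empty =>
    have h1 : ∀ z, (bernoulliPoly p ∅).intCoeff z = if z = 0 then 1 else 0 := by
      intro z
      simp only [bernoulliPoly, Finset.prod_empty, Polynomial.intCoeff, Polynomial.coeff_one]
      split_ifs <;> first | rfl | omega
    refine ⟨fun z => by rw [h1]; split_ifs <;> norm_num, fun i j k hij hk => ?_⟩
    simp only [h1]
    split_ifs <;> first | omega | norm_num
  | insert i s hi ih =>
    have := ih.convolve (sub_nonneg.2 (p i).2.2) (p i).2.1
    rw [bernoulliPoly, Finset.prod_insert hi]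
    convert this using 1
    exact funext fun z => Polynomial.intCoeff_linear_mul _ _ _ z

theorem sumOfBernoullis_logConcave {n : ℕ} (p : Fin n → unitInterval) {i j : ℕ} (hij : i ≤ j)
    (k : ℕ) : (sumOfBernoullis p).real {i} * (sumOfBernoullis p).real {j + k} ≤
      (sumOfBernoullis p).real {j} * (sumOfBernoullis p).real {i + k} := by
  have h := (logConcave_bernoulliPoly p Finset.univ).2 i j k (by omega) (by omega)
  simp only [Polynomial.intCoeff, ← Nat.cast_add, Int.natCast_nonneg, if_true,
    Int.toNat_natCast] at h
  simpa only [sumOfBernoullis_real_singleton] using h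

theorem bitSum_le {n : ℕ} (x : Fin n → Bool) : bitSum x ≤ n :=
  (Finset.sum_le_sum fun i _ => Bool.toNat_le (x i)).trans (by simp)

theorem sumOfBernoullis_ae_le {n : ℕ} (p : Fin n → unitInterval) :
    ∀ᵐ j ∂sumOfBernoullis p, j ≤ n := by
  rw [sumOfBernoullis, ae_map_iff (measurable_of_countable _).aemeasurable
    (Set.to_countable _).measurableSet]
  exact .of_forall bitSum_le

/-! ### Uniform convergence of the empirical distribution function -/

theorem sampleCount_zero_mono (y : ℕ → ℕ) (m : ℕ) {a b : ℕ} (h : a ≤ b) :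
    sampleCount y m 0 a ≤ sampleCount y m 0 b := by
  have := sampleCount_add y m (Nat.zero_le a) h
  omega

section EmpiricalDistribution

variable (μ : Measure ℕ) [IsProbabilityMeasure μ]

/-- Chebyshev's inequality for the empirical distribution function at a point. -/
theorem empirical_chebyshev (m x : ℕ) (hm : 0 < m) {c : ℝ} (hc : 0 < c) :
    (Measure.infinitePi fun _ : ℕ => μ).real
      {ω | c ≤ |(sampleCount ω m 0 x : ℝ) / m - μ.real (Set.Iio x)|} ≤ 1 / (4 * m * c ^ 2) := by
  have hm' : (0 : ℝ) < m := by exact_mod_cast hm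
  set P := Measure.infinitePi fun _ : ℕ => μ with hP
  let f : ℕ → ℝ := Set.indicator (Set.Iio x) 1
  let X : ℕ → (ℕ → ℕ) → ℝ := fun i ω => f (ω i)
  have hf : Measurable f := measurable_of_countable f
  have hXm : ∀ i, Measurable (X i) := fun i => hf.comp (measurable_pi_apply i)
  have hf01 : ∀ j, f j ∈ Set.Icc (0 : ℝ) 1 := fun j => by
    by_cases h : j < x <;> simp [f, h]
  have hXb : ∀ i, ∀ᵐ ω ∂P, X i ω ∈ Set.Icc (0 : ℝ) 1 := fun i => .of_forall fun ω => hf01 (ω i)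
  have hXL : ∀ i, MemLp (X i) 2 P := fun i =>
    memLp_of_bounded (hXb i) (hXm i).aestronglyMeasurable 2
  have hXe : ∀ i, ∫ ω, X i ω ∂P = μ.real (Set.Iio x) := fun i => by
    have h1 := (measurePreserving_eval_infinitePi (fun _ : ℕ => μ) i).map_eq
    have h2 : ∫ j, f j ∂(P.map (Function.eval i)) = ∫ ω, X i ω ∂P :=
      integral_map (measurable_pi_apply i).aemeasurable hf.aestronglyMeasurable
    rw [← h2, hP, h1, integral_indicator_one measurableSet_Iio]
  have hind : iIndepFun X P := iIndepFun_infinitePi (X := fun _ => f) fun _ => hf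
  -- A variable with values in `[0, 1]` has variance at most `1 / 4`.
  have hvar : variance (∑ i ∈ Finset.range m, X i) P ≤ m / 4 := by
    have hpair : Set.Pairwise (Finset.range m : Set ℕ) fun i j => IndepFun (X i) (X j) P :=
      fun i _ j _ hij => hind.indepFun hij
    rw [IndepFun.variance_sum (fun i _ => hXL i) hpair]
    calc ∑ i ∈ Finset.range m, variance (X i) P ≤ ∑ i ∈ Finset.range m, (1 / 4 : ℝ) := by
          refine Finset.sum_le_sum fun i _ => ?_
          have h := variance_le_sq_of_bounded (hXb i) (hXm i).aemeasurable
          norm_num at h ⊢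
          exact h
      _ = m / 4 := by simp; ring
  have hSL : MemLp (∑ i ∈ Finset.range m, X i) 2 P := memLp_finsetSum' _ fun i _ => hXL i
  have hSe : ∫ ω, (∑ i ∈ Finset.range m, X i) ω ∂P = m * μ.real (Set.Iio x) := by
    simp only [Finset.sum_apply]
    rw [integral_finsetSum _ fun i _ => (hXL i).integrable (by norm_num)]
    simp [hXe]
  have hS : ∀ ω : ℕ → ℕ, (∑ i ∈ Finset.range m, X i) ω = sampleCount ω m 0 x := fun ω => by
    simp [sampleCount, X, f, Set.indicator_apply]
  have key := meas_ge_le_variance_div_sq hSL (c := m * c) (by positivity)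
  have hset : {ω : ℕ → ℕ | c ≤ |(sampleCount ω m 0 x : ℝ) / m - μ.real (Set.Iio x)|} =
      {ω | m * c ≤ |(∑ i ∈ Finset.range m, X i) ω - ∫ ω, (∑ i ∈ Finset.range m, X i) ω ∂P|} := by
    ext ω
    rw [Set.mem_ofPred_eq, Set.mem_ofPred_eq, hSe, hS,
      show (sampleCount ω m 0 x : ℝ) - m * μ.real (Set.Iio x) =
        m * ((sampleCount ω m 0 x : ℝ) / m - μ.real (Set.Iio x)) by field_simp,
      abs_mul, abs_of_pos hm', mul_le_mul_iff_right₀ hm']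
  rw [hset, measureReal_def]
  refine (ENNReal.toReal_le_of_le_ofReal
    (div_nonneg (variance_nonneg _ _) (by positivity)) key).trans ?_
  calc variance (∑ i ∈ Finset.range m, X i) P / (m * c) ^ 2 ≤ (m / 4) / (m * c) ^ 2 := by gcongr
    _ = 1 / (4 * m * c ^ 2) := by field_simp

/-- With `80 * A ^ 3` samples the empirical distribution function is uniformly within `1 / A` of
the distribution function. -/
theorem empirical_uniform {n : ℕ} (hμ : ∀ᵐ j ∂μ, j ≤ n) {A m : ℕ} (hA : 0 < A)
    (hm : m = A * A * A * 80) :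
    (Measure.infinitePi fun _ : ℕ => μ).real
      {ω | ∀ x, |(sampleCount ω m 0 x : ℝ) / m - μ.real (Set.Iio x)| ≤ 1 / A}ᶜ ≤ 1 / 20 := by
  have hA' : (0 : ℝ) < A := by exact_mod_cast hA
  have hm0 : 0 < m := by rw [hm]; positivity
  have hm' : (0 : ℝ) < m := by exact_mod_cast hm0
  set G : ℕ → ℝ := fun x => μ.real (Set.Iio x) with hG
  have hGmono : Monotone G := fun a b h => measureReal_mono (Set.Iio_subset_Iio h)
  have hGn : G (n + 1) = 1 := by
    have : μ (Set.Iio (n + 1)) = 1 := by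
      rw [← measure_univ (μ := μ)]
      refine measure_congr ?_
      filter_upwards [hμ] with j hj
      exact propext ⟨fun _ => trivial, fun _ => Nat.lt_succ_of_le hj⟩
    simp [hG, measureReal_def, this]
  have hG1 : ∀ x, G x ≤ 1 := fun x => measureReal_le_one
  have hG0 : G 0 = 0 := by simp [hG]
  -- The `i / (2A)`-quantile. Since `G x` is the mass strictly below `x`, the quantile satisfies `G
  -- (q i) ≤ i / (2A) ≤ G (q i + 1)`. An atom at `q i` may be heavy, so the empirical function is
  -- controlled at both `q i` and `q i + 1`.
  let q : ℕ → ℕ := fun i => sInf {x | (i : ℝ) / (2 * A) ≤ G (x + 1)}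
  let bad : ℕ → Set (ℕ → ℕ) := fun x => {ω | 1 / (2 * A) ≤ |(sampleCount ω m 0 x : ℝ) / m - G x|}
  have hsub : {ω : ℕ → ℕ | ∀ x, |(sampleCount ω m 0 x : ℝ) / m - G x| ≤ 1 / A}ᶜ ⊆
      ⋃ i ∈ Finset.range (2 * A), (bad (q (i + 1)) ∪ bad (q (i + 1) + 1)) := by
    intro ω hω
    by_contra hgood
    simp only [Set.mem_iUnion, Set.mem_union, not_exists, not_or, Finset.mem_range, bad,
      Set.mem_ofPred_eq, not_le] at hgood
    refine hω fun x => ?_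
    have hkey : (1 : ℝ) / A = 1 / (2 * A) + 1 / (2 * A) := by field_simp; norm_num
    have hFmono : ∀ a b : ℕ, a ≤ b →
        (sampleCount ω m 0 a : ℝ) / m ≤ (sampleCount ω m 0 b : ℝ) / m := fun a b h => by
      have := sampleCount_zero_mono ω m h
      gcongr
    have hF1 : (sampleCount ω m 0 x : ℝ) / m ≤ 1 := by
      rw [div_le_one hm']
      exact_mod_cast sampleCount_le ω m 0 x
    have hF0 : 0 ≤ (sampleCount ω m 0 x : ℝ) / m := by positivity
    have hGx0 : 0 ≤ G x := measureReal_nonneg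
    have hpos : (0 : ℝ) < 1 / (2 * A) := by positivity
    -- `G x` lies in the `i`-th cell of width `1 / (2A)`, so `q i + 1 ≤ x ≤ q (i + 1)` except at the
    -- two ends. Monotonicity transfers the control at these points to `x`, with one further cell
    -- width of error.
    obtain ⟨i, hi⟩ : ∃ i, i = ⌊G x * (2 * A)⌋₊ := ⟨_, rfl⟩
    have hi1 : (i : ℝ) / (2 * A) ≤ G x := by
      rw [div_le_iff₀ (by positivity), hi]
      exact Nat.floor_le (by positivity)
    have hi2 : G x < ((i + 1 : ℕ) : ℝ) / (2 * A) := by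
      rw [lt_div_iff₀ (by positivity), hi]
      push_cast
      exact Nat.lt_floor_add_one _
    have hi3 : ((i + 1 : ℕ) : ℝ) / (2 * A) = i / (2 * A) + 1 / (2 * A) := by
      push_cast; ring
    have hik : i ≤ 2 * A := by
      have : (i : ℝ) ≤ 2 * A := by
        rw [div_le_iff₀ (by positivity)] at hi1
        nlinarith [hG1 x]
      exact_mod_cast this
    have hq : ∀ j : ℕ, {y | (j : ℝ) / (2 * A) ≤ G (y + 1)}.Nonempty →
        (j : ℝ) / (2 * A) ≤ G (q j + 1) := fun j hj => Nat.sInf_mem hj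
    rw [hkey, abs_le]
    constructor
    · rcases Nat.eq_zero_or_pos i with h0 | h0
      · have : (i : ℝ) / (2 * A) = 0 := by rw [h0]; simp
        linarith
      · obtain ⟨j, rfl⟩ : ∃ j, i = j + 1 := ⟨i - 1, by omega⟩
        obtain ⟨x', rfl⟩ : ∃ x', x = x' + 1 := by
          refine ⟨x - 1, ?_⟩
          have : x ≠ 0 := by
            rintro rfl
            rw [hG0] at hi1
            have : (0 : ℝ) < ((j + 1 : ℕ) : ℝ) / (2 * A) := by positivity
            linarith
          omega
        have h1 := hq (j + 1) ⟨x', hi1⟩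
        have h2 : q (j + 1) ≤ x' := Nat.sInf_le hi1
        have h3 := abs_lt.1 (hgood j (by omega)).2
        have h4 := hFmono (q (j + 1) + 1) (x' + 1) (by omega)
        linarith [h3.1]
    · rcases hik.eq_or_lt with h0 | h0
      · have : (i : ℝ) / (2 * A) = 1 := by rw [h0]; push_cast; field_simp
        linarith
      · have hne : {y | ((i + 1 : ℕ) : ℝ) / (2 * A) ≤ G (y + 1)}.Nonempty := by
          refine ⟨n, ?_⟩
          rw [Set.mem_ofPred_eq, hGn, div_le_one (by positivity)]
          exact_mod_cast h0
        have h1 : x ≤ q (i + 1) := by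
          by_contra h
          have := hq (i + 1) hne
          have := hGmono (show q (i + 1) + 1 ≤ x by omega)
          linarith
        have h2 : G (q (i + 1)) ≤ ((i + 1 : ℕ) : ℝ) / (2 * A) := by
          rcases Nat.eq_zero_or_pos (q (i + 1)) with h | h
          · rw [h, hG0]; positivity
          · have := Nat.notMem_of_lt_sInf (show q (i + 1) - 1 < q (i + 1) by omega)
            rw [Set.mem_ofPred_eq, not_le, Nat.sub_add_cancel h] at this
            exact this.le
        have h3 := abs_lt.1 (hgood i h0).1
        have h4 := hFmono x (q (i + 1)) h1
        linarith [h3.2]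
  -- Chebyshev with `c = 1 / (2A)` and `80A³` samples; the union of `4A` such events has probability
  -- at most `1 / 20`.
  have hbad : ∀ x, (Measure.infinitePi fun _ : ℕ => μ).real (bad x) ≤ 1 / (80 * A) := fun x => by
    refine (empirical_chebyshev μ m x hm0 (c := 1 / (2 * A)) (by positivity)).trans_eq ?_
    rw [hm]; push_cast; field_simp; norm_num
  calc _ ≤ (Measure.infinitePi fun _ : ℕ => μ).real
        (⋃ i ∈ Finset.range (2 * A), (bad (q (i + 1)) ∪ bad (q (i + 1) + 1))) :=
        measureReal_mono hsub (measure_ne_top _ _)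
    _ ≤ ∑ i ∈ Finset.range (2 * A), (Measure.infinitePi fun _ : ℕ => μ).real
        (bad (q (i + 1)) ∪ bad (q (i + 1) + 1)) := measureReal_biUnion_finset_le _ _
    _ ≤ ∑ i ∈ Finset.range (2 * A), (1 / (80 * A) + 1 / (80 * A) : ℝ) :=
        Finset.sum_le_sum fun i _ => (measureReal_union_le _ _).trans
          (add_le_add (hbad _) (hbad _))
    _ = 1 / 20 := by simp; field_simp; norm_num

end EmpiricalDistribution

/-! ### Approximation of a log-concave distribution by a histogram -/

section Flattening

variable {f : ℕ → ℝ} {n : ℕ}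

/-- The hazard rate of a log-concave sequence increases. -/
theorem mul_tail_le (h0 : ∀ j, 0 ≤ f j)
    (hlc : ∀ i j k, i ≤ j → f i * f (j + k) ≤ f j * f (i + k)) {i j : ℕ} (hij : i ≤ j)
    (hj : j ≤ n) :
    f i * ∑ k ∈ Finset.Ico j (n + 1), f k ≤ f j * ∑ k ∈ Finset.Ico i (n + 1), f k := by
  calc f i * ∑ k ∈ Finset.Ico j (n + 1), f k
      = ∑ k ∈ Finset.range (n + 1 - j), f i * f (j + k) := by
        rw [Finset.sum_Ico_eq_sum_range, Finset.mul_sum]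
    _ ≤ ∑ k ∈ Finset.range (n + 1 - j), f j * f (i + k) :=
        Finset.sum_le_sum fun k _ => hlc i j k hij
    _ ≤ ∑ k ∈ Finset.range (n + 1 - i), f j * f (i + k) :=
        Finset.sum_le_sum_of_subset_of_nonneg (Finset.range_mono (by omega))
          fun k _ _ => mul_nonneg (h0 _) (h0 _)
    _ = f j * ∑ k ∈ Finset.Ico i (n + 1), f k := by
        rw [Finset.sum_Ico_eq_sum_range, Finset.mul_sum]

/-- The reversed hazard rate of a log-concave sequence decreases. -/
theorem mul_head_le (h0 : ∀ j, 0 ≤ f j)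
    (hlc : ∀ i j k, i ≤ j → f i * f (j + k) ≤ f j * f (i + k)) {i j : ℕ} (hij : i ≤ j) :
    f j * ∑ k ∈ Finset.range (i + 1), f k ≤ f i * ∑ k ∈ Finset.range (j + 1), f k := by
  calc f j * ∑ k ∈ Finset.range (i + 1), f k
      = ∑ k ∈ Finset.range (i + 1), f k * f (i + (j - i)) := by
        rw [Finset.mul_sum, Nat.add_sub_cancel' hij]
        exact Finset.sum_congr rfl fun _ _ => mul_comm _ _
    _ ≤ ∑ k ∈ Finset.range (i + 1), f i * f ((j - i) + k) :=
        Finset.sum_le_sum fun k hk => by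
          rw [add_comm (j - i)]
          exact hlc k i (j - i) (by simp at hk; omega)
    _ = f i * ∑ k ∈ Finset.Ico (j - i) (j + 1), f k := by
        rw [Finset.sum_Ico_eq_sum_range, Finset.mul_sum, show j + 1 - (j - i) = i + 1 by omega]
    _ ≤ f i * ∑ k ∈ Finset.range (j + 1), f k := by
        refine mul_le_mul_of_nonneg_left ?_ (h0 i)
        refine Finset.sum_le_sum_of_subset_of_nonneg ?_ fun k _ _ => h0 k
        intro k; simp

/-- A bound on the error at `j` made by flattening `f` on an interval of mass at most `δ`. -/
noncomputable def flatteningError (f : ℕ → ℝ) (τ δ : ℝ) (j : ℕ) : ℝ :=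
  2 * (δ / τ) * f j + 2 * (if ∑ k ∈ Finset.range (j + 1), f k ≤ τ + δ then f j else 0) +
    2 * (if 1 - ∑ k ∈ Finset.range j, f k ≤ τ + δ then f j else 0)

theorem flatteningError_nonneg (h0 : ∀ j, 0 ≤ f j) {τ δ : ℝ} (hτ : 0 < τ) (hδ : 0 ≤ δ) (j : ℕ) :
    0 ≤ flatteningError f τ δ j := by
  have := h0 j
  unfold flatteningError
  split_ifs <;> positivity

theorem sum_range_mono (h0 : ∀ j, 0 ≤ f j) : Monotone fun x => ∑ k ∈ Finset.range x, f k :=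
  fun _ _ h => Finset.sum_le_sum_of_subset_of_nonneg (Finset.range_mono h) fun k _ _ => h0 k

/-- The indices that satisfy a tail condition lie in an initial or final segment whose whole mass is
at most `τ + δ`, as is seen at the extreme such index. The point `n` is left out because its bin
receives the remainder. -/
theorem sum_flatteningError_le (h0 : ∀ j, 0 ≤ f j) (h1 : ∑ k ∈ Finset.range (n + 1), f k = 1)
    {τ δ : ℝ} (hτ : 0 < τ) (hδ : 0 ≤ δ) :
    ∑ j ∈ Finset.range n, flatteningError f τ δ j ≤ 2 * (δ / τ) + 4 * (τ + δ) := by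
  have hS := sum_range_mono h0
  have ha : ∑ j ∈ Finset.range n, f j ≤ 1 := (hS (Nat.le_succ n)).trans h1.le
  have hb : ∑ j ∈ Finset.range n,
      (if ∑ k ∈ Finset.range (j + 1), f k ≤ τ + δ then f j else 0) ≤ τ + δ := by
    rw [← Finset.sum_filter]
    set s := (Finset.range n).filter fun j => ∑ k ∈ Finset.range (j + 1), f k ≤ τ + δ with hs
    rcases s.eq_empty_or_nonempty with h | h
    · rw [h]; simp; positivity
    · have hm := Finset.mem_filter.1 (s.max'_mem h)
      refine le_trans (Finset.sum_le_sum_of_subset_of_nonneg ?_ fun k _ _ => h0 k) hm.2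
      intro j hj
      have := s.le_max' j hj
      simp; omega
  have hc : ∑ j ∈ Finset.range n,
      (if 1 - ∑ k ∈ Finset.range j, f k ≤ τ + δ then f j else 0) ≤ τ + δ := by
    rw [← Finset.sum_filter]
    set s := (Finset.range n).filter fun j => 1 - ∑ k ∈ Finset.range j, f k ≤ τ + δ with hs
    rcases s.eq_empty_or_nonempty with h | h
    · rw [h]; simp; positivity
    · have hm := Finset.mem_filter.1 (s.min'_mem h)
      have hmn := Finset.mem_range.1 hm.1
      refine le_trans ?_ hm.2
      rw [← h1, ← Finset.sum_Ico_eq_sub _ (by omega)]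
      refine Finset.sum_le_sum_of_subset_of_nonneg ?_ fun k _ _ => h0 k
      intro j hj
      have h2 := s.min'_le j hj
      have h3 := Finset.mem_range.1 (Finset.mem_filter.1 hj).1
      simp; omega
  simp only [flatteningError, Finset.sum_add_distrib, ← Finset.mul_sum]
  have : 2 * (δ / τ) * ∑ j ∈ Finset.range n, f j ≤ 2 * (δ / τ) * 1 := by gcongr
  linarith

/-- On an interval of small mass that is not in the tails, a log-concave distribution is nearly
constant. -/
theorem le_mul_of_mem_Ico (h0 : ∀ j, 0 ≤ f j)
    (hlc : ∀ i j k, i ≤ j → f i * f (j + k) ≤ f j * f (i + k))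
    (h1 : ∑ k ∈ Finset.range (n + 1), f k = 1) {τ δ : ℝ} (hτ : 0 < τ) {a b : ℕ}
    (hb : b ≤ n + 1) (hmass : ∑ k ∈ Finset.Ico a b, f k ≤ δ)
    (hl : τ ≤ ∑ k ∈ Finset.range (a + 1), f k)
    (hr : τ ≤ 1 - ∑ k ∈ Finset.range (b - 1), f k) {i j : ℕ}
    (hi : i ∈ Finset.Ico a b) (hj : j ∈ Finset.Ico a b) : f i ≤ (1 + δ / τ) * f j := by
  rw [Finset.mem_Ico] at hi hj
  have hsub : ∀ c d, a ≤ c → d ≤ b → ∑ k ∈ Finset.Ico c d, f k ≤ δ := fun c d hc hd =>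
    (Finset.sum_le_sum_of_subset_of_nonneg (Finset.Ico_subset_Ico hc hd) fun k _ _ => h0 k).trans
      hmass
  have hδ : 0 ≤ δ := (Finset.sum_nonneg fun k _ => h0 k).trans hmass
  have hS := sum_range_mono h0
  -- `T` will be the tail from `j` on if `i ≤ j`, and the head up to `j` otherwise. The
  -- corresponding sum at `i` exceeds it by at most the mass `δ` of the interval.
  have key : ∀ T : ℝ, τ ≤ T → f i * T ≤ f j * (T + δ) → f i ≤ (1 + δ / τ) * f j := by
    intro T hT h
    have hT0 : 0 < T := hτ.trans_le hT
    have : f i ≤ (1 + δ / T) * f j := by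
      rw [← mul_le_mul_iff_left₀ hT0]
      calc f i * T ≤ f j * (T + δ) := h
        _ = (1 + δ / T) * f j * T := by field_simp
    refine this.trans (mul_le_mul_of_nonneg_right ?_ (h0 j))
    gcongr
  rcases le_total i j with hij | hij
  · have h := mul_tail_le h0 hlc hij (n := n) (by omega)
    refine key (∑ k ∈ Finset.Ico j (n + 1), f k) ?_ (h.trans ?_)
    · rw [Finset.sum_Ico_eq_sub _ (by omega), h1]
      have := hS (show j ≤ b - 1 by omega)
      simp only at this
      linarith
    · rw [← Finset.sum_Ico_consecutive f hij (show j ≤ n + 1 by omega), add_comm]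
      exact mul_le_mul_of_nonneg_left (by linarith [hsub i j hi.1 hj.2.le]) (h0 j)
  · have h := mul_head_le h0 hlc hij
    refine key (∑ k ∈ Finset.range (j + 1), f k) ?_ (h.trans ?_)
    · exact hl.trans (hS (by omega))
    · rw [← Finset.sum_range_add_sum_Ico f (show j + 1 ≤ i + 1 by omega)]
      exact mul_le_mul_of_nonneg_left (by linarith [hsub (j + 1) (i + 1) (by omega) (by omega)])
        (h0 j)

/-- A single point is reproduced exactly, so only longer intervals need small mass. If both tails
are at least `τ`, near-constancy bounds the error by `2 * (δ / τ)` times the mass. Otherwise every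
point of the interval satisfies a tail condition, and the trivial bound of twice the mass suffices.
-/
theorem sum_flattening_le (h0 : ∀ j, 0 ≤ f j)
    (hlc : ∀ i j k, i ≤ j → f i * f (j + k) ≤ f j * f (i + k))
    (h1 : ∑ k ∈ Finset.range (n + 1), f k = 1) {τ δ : ℝ} (hτ : 0 < τ) (hδ : 0 ≤ δ) {a b : ℕ}
    (hab : a < b) (hb : b ≤ n + 1) (hmass : b ≠ a + 1 → ∑ k ∈ Finset.Ico a b, f k ≤ δ) :
    ∑ j ∈ Finset.Ico a b, |f j - (∑ k ∈ Finset.Ico a b, f k) / ((b - a : ℕ) : ℝ)| ≤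
      ∑ j ∈ Finset.Ico a b, flatteningError f τ δ j := by
  rcases eq_or_ne b (a + 1) with rfl | hne
  · simpa using flatteningError_nonneg h0 hτ hδ a
  replace hmass := hmass hne
  set w := ∑ k ∈ Finset.Ico a b, f k with hw
  have hl0 : (0 : ℝ) < ((b - a : ℕ) : ℝ) := by exact_mod_cast Nat.sub_pos_of_lt hab
  have hw0 : 0 ≤ w := Finset.sum_nonneg fun k _ => h0 k
  have hρ : 0 ≤ δ / τ := by positivity
  have hS := sum_range_mono h0
  have hwS : ∑ k ∈ Finset.range b, f k = ∑ k ∈ Finset.range a, f k + w :=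
    (Finset.sum_range_add_sum_Ico f hab.le).symm
  set v := w / ((b - a : ℕ) : ℝ) with hv
  have hv0 : 0 ≤ v := by positivity
  have hsum : ∑ j ∈ Finset.Ico a b, (f j + v) = 2 * w := by
    rw [Finset.sum_add_distrib, Finset.sum_const, Nat.card_Ico, nsmul_eq_mul, hv,
      mul_div_cancel₀ _ hl0.ne']
    ring
  have hcrude : ∑ j ∈ Finset.Ico a b, |f j - v| ≤ 2 * w := by
    rw [← hsum]
    refine Finset.sum_le_sum fun j _ => ?_
    rw [abs_le]
    constructor <;> linarith [h0 j]
  by_cases hl : τ ≤ ∑ k ∈ Finset.range (a + 1), f k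
  · by_cases hr : τ ≤ 1 - ∑ k ∈ Finset.range (b - 1), f k
    · have key := fun i j => le_mul_of_mem_Ico (i := i) (j := j) h0 hlc h1 hτ hb hmass hl hr
      have hconst : ∀ x : ℝ, ∑ _i ∈ Finset.Ico a b, x = ((b - a : ℕ) : ℝ) * x := fun x => by simp
      have hvle : ∀ j ∈ Finset.Ico a b, v ≤ (1 + δ / τ) * f j := fun j hj => by
        rw [hv, div_le_iff₀ hl0, mul_comm _ ((b - a : ℕ) : ℝ), ← hconst]
        exact Finset.sum_le_sum fun i hi => key i j hi hj
      have hlev : ∀ j ∈ Finset.Ico a b, f j ≤ (1 + δ / τ) * v := fun j hj => by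
        rw [hv, ← mul_div_assoc, le_div_iff₀ hl0, mul_comm _ ((b - a : ℕ) : ℝ), ← hconst,
          Finset.mul_sum]
        exact Finset.sum_le_sum fun i hi => key j i hj hi
      have h2 : ∑ j ∈ Finset.Ico a b, |f j - v| ≤ ∑ j ∈ Finset.Ico a b, δ / τ * (f j + v) := by
        refine Finset.sum_le_sum fun j hj => ?_
        have h3 := hvle j hj
        have h4 := hlev j hj
        have h5 := mul_nonneg hρ (h0 j)
        have h6 := mul_nonneg hρ hv0
        rw [abs_le]
        constructor <;> linarith
      refine h2.trans ?_
      rw [← Finset.mul_sum, hsum, hw, ← mul_assoc, Finset.mul_sum]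
      refine Finset.sum_le_sum fun j _ => ?_
      have := h0 j
      unfold flatteningError
      have : 0 ≤ (if ∑ k ∈ Finset.range (j + 1), f k ≤ τ + δ then f j else 0) := by
        split_ifs <;> simp [this]
      have : 0 ≤ (if 1 - ∑ k ∈ Finset.range j, f k ≤ τ + δ then f j else 0) := by
        split_ifs <;> simp [h0 j]
      linarith
    · refine hcrude.trans ?_
      rw [hw, Finset.mul_sum]
      refine Finset.sum_le_sum fun j hj => ?_
      rw [Finset.mem_Ico] at hj
      have h2 : 1 - ∑ k ∈ Finset.range j, f k ≤ τ + δ := by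
        have e1 := hS hj.1
        have e2 := hS (show b - 1 ≤ b by omega)
        simp only at e1 e2
        linarith
      unfold flatteningError
      rw [if_pos h2]
      have := mul_nonneg (mul_nonneg zero_le_two hρ) (h0 j)
      have : 0 ≤ (if ∑ k ∈ Finset.range (j + 1), f k ≤ τ + δ then f j else 0) := by
        split_ifs <;> simp [h0 j]
      linarith
  · refine hcrude.trans ?_
    rw [hw, Finset.mul_sum]
    refine Finset.sum_le_sum fun j hj => ?_
    rw [Finset.mem_Ico] at hj
    have h2 : ∑ k ∈ Finset.range (j + 1), f k ≤ τ + δ := by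
      have e1 := hS (show j + 1 ≤ b by omega)
      have e2 := hS (show a ≤ a + 1 by omega)
      simp only at e1 e2
      linarith
    unfold flatteningError
    rw [if_pos h2]
    have := mul_nonneg (mul_nonneg zero_le_two hρ) (h0 j)
    have : 0 ≤ (if 1 - ∑ k ∈ Finset.range j, f k ≤ τ + δ then f j else 0) := by
      split_ifs <;> simp [h0 j]
    linarith

end Flattening

/-! ### The total error of the histogram -/

section Walk

variable {f : ℕ → ℝ} {y : ℕ → ℕ} {K M R n : ℕ}

theorem abs_sampleCount_div_sub_le {η : ℝ}
    (h : ∀ x, |(sampleCount y M 0 x : ℝ) / M - ∑ k ∈ Finset.range x, f k| ≤ η) {a b : ℕ}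
    (hab : a ≤ b) :
    |(sampleCount y M a b : ℝ) / M - ∑ k ∈ Finset.Ico a b, f k| ≤ 2 * η := by
  have h1 : (sampleCount y M 0 a : ℝ) + sampleCount y M a b = sampleCount y M 0 b := by
    exact_mod_cast sampleCount_add y M (Nat.zero_le a) hab
  have h2 := abs_le.1 (h a)
  have h3 := abs_le.1 (h b)
  rw [← h1, add_div] at h3
  rw [Finset.sum_Ico_eq_sub _ hab, abs_le]
  constructor <;> linarith [h2.1, h2.2, h3.1, h3.2]

/-- Rounding down to a multiple of the length loses at most one length; summed over the bins this
telescopes to `n / R`. -/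
theorem abs_binWeight_sub_le (hM : 0 < M) (hR : 0 < R) {a b : ℕ} (hab : a < b) :
    |(binWeight y M R a b : ℝ) / R - (sampleCount y M a b : ℝ) / M| ≤ ((b : ℝ) - a) / R := by
  have hl : 0 < b - a := Nat.sub_pos_of_lt hab
  have hlr : ((b - a : ℕ) : ℝ) = (b : ℝ) - a := Nat.cast_sub hab.le
  have hM' : (0 : ℝ) < M := by exact_mod_cast hM
  have hR' : (0 : ℝ) < R := by exact_mod_cast hR
  have h1 : (M : ℝ) * binWeight y M R a b ≤ sampleCount y M a b * R := by
    exact_mod_cast mul_binWeight_le y M R a b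
  have h2 : (sampleCount y M a b : ℝ) * R ≤ M * binWeight y M R a b + M * (b - a) := by
    rw [← hlr]
    have := Nat.lt_mul_div_succ (sampleCount y M a b * R) (Nat.mul_pos hM hl)
    have h3 : sampleCount y M a b * R ≤ M * binWeight y M R a b + M * (b - a) := by
      rw [binWeight, ← mul_assoc, ← Nat.mul_succ]
      exact this.le
    exact_mod_cast h3
  have e : (binWeight y M R a b : ℝ) / R - (sampleCount y M a b : ℝ) / M =
      (M * binWeight y M R a b - sampleCount y M a b * R) / (M * R) := by field_simp
  rw [e, abs_div, abs_of_pos (mul_pos hM' hR'), div_le_div_iff₀ (mul_pos hM' hR') hR',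
    abs_of_nonpos (by linarith)]
  nlinarith

/-- A sample in `[a, b)` would give a breakpoint `y` or `y + 1` in `(a, b)`, unless `b = a + 1`. -/
theorem sampleCount_eq_zero_of_isLeast {a b : ℕ}
    (hb : IsLeast {v | a < v ∧ Breakpoint y K n v} b) (hne : b ≠ a + 1) :
    sampleCount y K a b = 0 := by
  rw [sampleCount, Finset.card_eq_zero, Finset.filter_eq_empty_iff]
  rintro i hi ⟨h1, h2⟩
  rw [Finset.mem_range] at hi
  have hab := hb.1.1
  rcases h1.eq_or_lt with h | h
  · have : b ≤ y i + 1 := hb.2 ⟨by omega, .inr ⟨i, hi, .inr rfl⟩⟩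
    omega
  · have : b ≤ y i := hb.2 ⟨h, .inr ⟨i, hi, .inl rfl⟩⟩
    omega

/-- The error in the weight of each bin counts twice: once in the bin itself, and once in the
remainder that ends up on the point `n`. The last summand carries this remainder through the
induction. -/
theorem Binned.sum_abs_sub_le (h0 : ∀ j, 0 ≤ f j)
    (hlc : ∀ i j k, i ≤ j → f i * f (j + k) ≤ f j * f (i + k))
    (h1 : ∑ k ∈ Finset.range (n + 1), f k = 1) {τ δ η : ℝ} (hτ : 0 < τ) (hδ : 0 ≤ δ)
    (hM : 0 < M) (hR : 0 < R)
    (hyK : ∀ x, |(sampleCount y K 0 x : ℝ) / K - ∑ k ∈ Finset.range x, f k| ≤ δ / 2)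
    (hyM : ∀ x, |(sampleCount y M 0 x : ℝ) / M - ∑ k ∈ Finset.range x, f k| ≤ η)
    {a r : ℕ} {bs : List (ℕ × ℕ)} (h : Binned y K M R n a r bs)
    (hr : sampleCount y M a n * R ≤ M * r) :
    ∑ j ∈ Finset.Ico a (n + 1), |f j - Histogram.pointWeight bs (j - a) / R| ≤
      ∑ j ∈ Finset.Ico a n, flatteningError f τ δ j +
      2 * (((bs.length : ℝ) - 1) * (2 * η) + ((n : ℝ) - a) / R) +
      |∑ k ∈ Finset.Ico a (n + 1), f k - r / R| := by
  induction h with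
  | last r => simp [Histogram.pointWeight]
  | @step a b r bs ha hb h ih =>
    have hab := hb.1.1
    have hbn := h.le
    have hcount := sampleCount_add y M hab.le hbn
    have hwM := mul_binWeight_le y M R a b
    have hwr : binWeight y M R a b ≤ r := by
      refine Nat.le_of_mul_le_mul_left (hwM.trans (le_trans ?_ hr)) hM
      gcongr
      omega
    have ih := ih (by rw [← hcount, add_mul] at hr; rw [Nat.mul_sub]; omega)
    set w := binWeight y M R a b with hw
    set m := ∑ k ∈ Finset.Ico a b, f k with hm
    have hl0 : (0 : ℝ) < ((b - a : ℕ) : ℝ) := by exact_mod_cast Nat.sub_pos_of_lt hab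
    have hR' : (0 : ℝ) < R := by exact_mod_cast hR
    have hwt : |m - w / R| ≤ 2 * η + ((b : ℝ) - a) / R := by
      have e1 := abs_le.1 (abs_sampleCount_div_sub_le hyM hab.le)
      have e2 := abs_le.1 (abs_binWeight_sub_le (y := y) hM hR hab)
      rw [abs_le]
      constructor <;> linarith [e1.1, e1.2, e2.1, e2.2]
    have hmass : b ≠ a + 1 → m ≤ δ := fun hne => by
      have e1 := abs_le.1 (abs_sampleCount_div_sub_le hyK hab.le)
      rw [sampleCount_eq_zero_of_isLeast hb hne] at e1
      simp only [Nat.cast_zero, zero_div] at e1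
      linarith [e1.1]
    have hflat := sum_flattening_le h0 hlc h1 hτ hδ hab (by omega) hmass
    have hfst : ∑ j ∈ Finset.Ico a b,
        |f j - Histogram.pointWeight ((b - a, w) :: bs) (j - a) / R| ≤
        ∑ j ∈ Finset.Ico a b, flatteningError f τ δ j + |m - w / R| := by
      calc _ ≤ ∑ j ∈ Finset.Ico a b,
            (|f j - m / ((b - a : ℕ) : ℝ)| + |m - w / R| / ((b - a : ℕ) : ℝ)) := by
            refine Finset.sum_le_sum fun j hj => ?_
            rw [Finset.mem_Ico] at hj
            rw [Histogram.pointWeight, if_pos (by omega)]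
            have e : f j - (w : ℝ) / ((b - a : ℕ) : ℝ) / R = (f j - m / ((b - a : ℕ) : ℝ)) +
                (m - w / R) / ((b - a : ℕ) : ℝ) := by field_simp; ring
            rw [e]
            refine (abs_add_le _ _).trans_eq ?_
            rw [abs_div (m - w / R), abs_of_pos hl0]
        _ = ∑ j ∈ Finset.Ico a b, |f j - m / ((b - a : ℕ) : ℝ)| + |m - w / R| := by
            rw [Finset.sum_add_distrib, Finset.sum_const, Nat.card_Ico, nsmul_eq_mul,
              mul_div_cancel₀ _ hl0.ne']
        _ ≤ _ := by linarith
    have hsnd : ∑ j ∈ Finset.Ico b (n + 1),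
        |f j - Histogram.pointWeight ((b - a, w) :: bs) (j - a) / R| =
        ∑ j ∈ Finset.Ico b (n + 1), |f j - Histogram.pointWeight bs (j - b) / R| := by
      refine Finset.sum_congr rfl fun j hj => ?_
      rw [Finset.mem_Ico] at hj
      rw [Histogram.pointWeight, if_neg (by omega), show j - a - (b - a) = j - b by omega]
    have hrem : |∑ k ∈ Finset.Ico b (n + 1), f k - ((r - w : ℕ) : ℝ) / R| ≤
        |∑ k ∈ Finset.Ico a (n + 1), f k - r / R| + |m - w / R| := by
      have e : ∑ k ∈ Finset.Ico b (n + 1), f k - ((r - w : ℕ) : ℝ) / R =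
          (∑ k ∈ Finset.Ico a (n + 1), f k - r / R) - (m - w / R) := by
        rw [← Finset.sum_Ico_consecutive f hab.le (show b ≤ n + 1 by omega), Nat.cast_sub hwr,
          sub_div]
        ring
      rw [e]
      exact abs_sub _ _
    rw [← Finset.sum_Ico_consecutive _ hab.le (show b ≤ n + 1 by omega), hsnd,
      ← Finset.sum_Ico_consecutive (flatteningError f τ δ) hab.le hbn]
    have e : ((n : ℝ) - a) / R = ((n : ℝ) - b) / R + ((b : ℝ) - a) / R := by ring
    rw [e]
    simp only [List.length_cons, Nat.cast_add, Nat.cast_one]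
    linarith

end Walk

theorem sumOfBernoullis_real_Iio {n : ℕ} (p : Fin n → unitInterval) (x : ℕ) :
    (sumOfBernoullis p).real (Set.Iio x) =
      ∑ k ∈ Finset.range x, (sumOfBernoullis p).real {k} := by
  rw [sum_measureReal_singleton, Finset.coe_range]

open Learner in
/-- The histogram of the learner is close to the target distribution if the empirical distribution
functions are. -/
theorem Binned.tvDist_le {n E : ℕ} (hn : 1 ≤ n) (hE : 1 ≤ E) (p : Fin n → unitInterval)
    {y : ℕ → ℕ} {bs : List (ℕ × ℕ)}
    (h : Binned y (firstCount E) (secondCount E) (2 ^ weightLog n E) n 0 (2 ^ weightLog n E) bs)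
    (hyK : ∀ x, |(sampleCount y (firstCount E) 0 x : ℝ) / firstCount E -
      (sumOfBernoullis p).real (Set.Iio x)| ≤ 1 / firstScale E)
    (hyM : ∀ x, |(sampleCount y (secondCount E) 0 x : ℝ) / secondCount E -
      (sumOfBernoullis p).real (Set.Iio x)| ≤ 1 / secondScale E) :
    Histogram.tvDist n (sumOfBernoullis p) ⟨bs⟩ ≤ 1 / E := by
  have hE' : (1 : ℝ) ≤ E := by exact_mod_cast hE
  have hb := numberBound_bounds hn hE
  have hM : 0 < secondCount E := by omega
  have hR : 0 < 2 ^ weightLog n E := by positivity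
  have hR4 : (n : ℝ) * E * 4 ≤ ((2 ^ weightLog n E : ℕ) : ℝ) := by
    exact_mod_cast (weight_bounds hn hE).1
  have hlen : (bs.length : ℝ) ≤ 2 * firstCount E + 2 := by exact_mod_cast h.length_le
  have hA1 : (firstScale E : ℝ) = E * E * 128 := by simp [firstScale]
  have hA2 : (secondScale E : ℝ) = (firstCount E + firstCount E + 1) * E * 8 := by
    simp [secondScale]
  have hr : sampleCount y (secondCount E) 0 n * 2 ^ weightLog n E ≤
      secondCount E * 2 ^ weightLog n E := Nat.mul_le_mul_right _ (sampleCount_le _ _ _ _)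
  have hwt : Histogram.totalWeight ⟨bs⟩ = 2 ^ weightLog n E := h.wt_eq hM hr
  set f : ℕ → ℝ := fun j => (sumOfBernoullis p).real {j} with hf
  have h0 : ∀ j, 0 ≤ f j := fun j => measureReal_nonneg
  have h1 : ∑ k ∈ Finset.range (n + 1), f k = 1 := by
    rw [← sumOfBernoullis_real_Iio]
    have : sumOfBernoullis p (Set.Iio (n + 1)) = 1 := by
      rw [← measure_univ (μ := sumOfBernoullis p)]
      refine measure_congr ?_
      filter_upwards [sumOfBernoullis_ae_le p] with j hj
      exact propext ⟨fun _ => trivial, fun _ => Nat.lt_succ_of_le hj⟩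
    simp [measureReal_def, this]
  simp only [sumOfBernoullis_real_Iio] at hyK hyM
  -- With `δ = 1 / (64E²)` and `τ = 1 / (8E)` one has `δ / τ = 1 / (8E)`, so flattening costs at
  -- most `13 / (16E)`. Estimation and rounding cost at most `2 * (1 / (4E) + 1 / (4E))`. Half of
  -- the sum is at most `29 / (32E)`.
  have hmain := h.sum_abs_sub_le (f := f) (τ := 1 / (8 * E)) (δ := 2 * (1 / firstScale E))
    (η := 1 / secondScale E) h0 (fun i j k hij => sumOfBernoullis_logConcave p hij k) h1
    (by positivity) (by positivity) hM hR (fun x => (hyK x).trans_eq (by ring)) hyM hr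
  have herr := sum_flatteningError_le (n := n) (τ := 1 / (8 * E)) (δ := 2 * (1 / firstScale E)) h0 h1
    (by positivity) (by positivity)
  have htv : Histogram.tvDist n (sumOfBernoullis p) ⟨bs⟩ = 1 / 2 * ∑ j ∈ Finset.Ico 0 (n + 1),
      |f j - Histogram.pointWeight bs (j - 0) / ((2 ^ weightLog n E : ℕ) : ℝ)| := by
    rw [Histogram.tvDist, Finset.range_eq_Ico]
    simp only [Histogram.prob, hwt, Nat.sub_zero, hf]
  have hR0 : (0 : ℝ) < ((2 ^ weightLog n E : ℕ) : ℝ) := by positivity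
  have e1 : ((n : ℝ) - (0 : ℕ)) / ((2 ^ weightLog n E : ℕ) : ℝ) ≤ 1 / (4 * E) := by
    rw [div_le_div_iff₀ hR0 (by positivity)]
    push_cast at hR4 ⊢
    linarith
  have e2 : ((bs.length : ℝ) - 1) * (2 * (1 / secondScale E)) ≤ 1 / (4 * E) := by
    calc ((bs.length : ℝ) - 1) * (2 * (1 / secondScale E))
        ≤ (firstCount E + firstCount E + 1) * (2 * (1 / secondScale E)) := by
          gcongr; linarith
      _ = 1 / (4 * E) := by rw [hA2]; field_simp; norm_num
  have e3 : |∑ k ∈ Finset.Ico 0 (n + 1), f k -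
      ((2 ^ weightLog n E : ℕ) : ℝ) / ((2 ^ weightLog n E : ℕ) : ℝ)| = 0 := by
    rw [← Finset.range_eq_Ico, h1, div_self hR0.ne', sub_self, abs_zero]
  have e4 : 2 * (1 / (firstScale E : ℝ)) ≤ 1 / (64 * E) := by
    rw [hA1, mul_one_div, div_le_div_iff₀ (by positivity) (by positivity)]
    nlinarith
  have e5 : 2 * (1 / (firstScale E : ℝ)) / (1 / (8 * E)) = 1 / (8 * E) := by
    rw [hA1]; field_simp; norm_num
  rw [e5] at herr
  rw [← Finset.range_eq_Ico n, e3] at hmain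
  rw [htv]
  have e6 : (1 : ℝ) / (8 * E) = 1 / 8 * (1 / E) := by ring
  have e7 : (1 : ℝ) / (4 * E) = 1 / 4 * (1 / E) := by ring
  have e8 : (1 : ℝ) / (64 * E) = 1 / 64 * (1 / E) := by ring
  rw [e6] at herr hmain
  rw [e7] at e1 e2
  rw [e8] at e4
  have e9 : (0 : ℝ) < 1 / E := by positivity
  linarith

/-! ### Asymptotic bounds and the theorem -/

namespace Learner

theorem secondCount_le {E : ℕ} (hE : 1 ≤ E) :
    secondCount E ≤ (8 * (2 * (128 ^ 3 * 80) + 1)) ^ 3 * 80 * E ^ 21 := by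
  have h1 : firstCount E = 128 ^ 3 * 80 * E ^ 6 := by
    rw [firstCount, firstScale]; ring
  have h2 : 1 ≤ E ^ 6 := Nat.one_le_pow _ _ hE
  have h3 : secondScale E ≤ 8 * (2 * (128 ^ 3 * 80) + 1) * E ^ 7 := by
    rw [secondScale, h1]
    calc (128 ^ 3 * 80 * E ^ 6 + 128 ^ 3 * 80 * E ^ 6 + 1) * E * 8
        ≤ (128 ^ 3 * 80 * E ^ 6 + 128 ^ 3 * 80 * E ^ 6 + E ^ 6) * E * 8 := by gcongr
      _ = 8 * (2 * (128 ^ 3 * 80) + 1) * E ^ 7 := by ring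
  calc secondCount E = secondScale E ^ 3 * 80 := by rw [secondCount]; ring
    _ ≤ (8 * (2 * (128 ^ 3 * 80) + 1) * E ^ 7) ^ 3 * 80 := by gcongr
    _ = _ := by ring

/-- The size of a number is its binary logarithm up to `1`. The estimates `log E ≤ E ≤ 2 / ε` put
the powers of `E` into the factor `1 / ε`, and `log n ≥ log 2` absorbs additive constants; hence the
second division by `Real.log 2`. -/
theorem exists_bounds : ∃ a D : ℝ, 0 < a ∧ 0 < D ∧ ∀ (n : ℕ) (ε : ℝ), 2 ≤ n → 0 < ε → ε ≤ 1 →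
    (secondCount ⌈1 / ε⌉₊ : ℝ) ≤ a * (1 / ε) ^ 21 ∧
    (1 + (numberBound n ⌈1 / ε⌉₊).size : ℝ) ≤ D * Real.log n * (1 / ε) ∧
    (weightLog n ⌈1 / ε⌉₊ : ℝ) ≤ D * Real.log (n / ε) := by
  obtain ⟨q, hq⟩ : ∃ q : ℕ, q = (8 * (2 * (128 ^ 3 * 80) + 1)) ^ 3 * 80 := ⟨_, rfl⟩
  have hq1 : 1 ≤ q := by rw [hq]; norm_num
  have hq1' : (1 : ℝ) ≤ q := by exact_mod_cast hq1
  have hl2 : 0 < Real.log 2 := Real.log_pos (by norm_num)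
  have hl2' : Real.log 2 ≤ 1 := by linarith [Real.log_two_lt_d9]
  have hlq : 0 ≤ Real.log (32 * q) := Real.log_nonneg (by linarith)
  refine ⟨q * 2 ^ 21, (6 + Real.log (32 * q) + 44) / (Real.log 2 * Real.log 2), by positivity,
    by positivity, ?_⟩
  intro n ε hn hε hε1
  set x := 1 / ε with hx
  have hx1 : 1 ≤ x := by rw [hx, le_div_iff₀ hε]; linarith
  set E := ⌈x⌉₊ with hE
  have hE1 : 1 ≤ E := Nat.one_le_ceil_iff.2 (by linarith)
  have hE1' : (1 : ℝ) ≤ E := by exact_mod_cast hE1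
  have hE2 : (E : ℝ) ≤ 2 * x := by linarith [Nat.ceil_lt_add_one (show 0 ≤ x by linarith)]
  have hn' : (2 : ℝ) ≤ n := by exact_mod_cast hn
  have hL : Real.log 2 ≤ Real.log n := Real.log_le_log (by norm_num) hn'
  have hM : (secondCount E : ℝ) ≤ q * E ^ 21 := by
    rw [hq]; exact_mod_cast secondCount_le hE1
  have hb := numberBound_bounds (n := n) (by omega) hE1
  refine ⟨hM.trans ?_, ?_, ?_⟩
  · calc (q : ℝ) * E ^ 21 ≤ q * (2 * x) ^ 21 := by gcongr
      _ = q * 2 ^ 21 * x ^ 21 := by ring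
  · have hBpos : 0 < numberBound n E := by omega
    obtain ⟨k, hk⟩ : ∃ k, (numberBound n E).size = k + 1 :=
      ⟨_, (Nat.sub_add_cancel (Nat.size_pos.2 hBpos)).symm⟩
    have h1 : 2 ^ k ≤ numberBound n E := Nat.lt_size.1 (by omega)
    have h2 : ((2 : ℝ) ^ k) ≤ 16 * n * E * (q * E ^ 21) := by
      calc ((2 : ℝ) ^ k) ≤ (numberBound n E : ℝ) := by exact_mod_cast h1
        _ = 16 * n * E * secondCount E := by rw [numberBound]; push_cast; ring
        _ ≤ _ := by gcongr
    have h3 : (2 : ℝ) ^ (k + 1) ≤ 32 * q * n * E ^ 22 := by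
      rw [pow_succ]; linarith [h2, show (16 * n * E * (q * E ^ 21) : ℝ) * 2 =
        32 * q * n * E ^ 22 by ring]
    have h4 := Real.log_le_log (by positivity) h3
    rw [Real.log_pow, Real.log_mul (by positivity) (by positivity),
      Real.log_mul (by positivity) (by positivity), Real.log_pow] at h4
    have h5 : Real.log E ≤ 2 * x := (Real.log_le_self (by positivity)).trans hE2
    rw [hk, div_mul_eq_mul_div, div_mul_eq_mul_div, le_div_iff₀ (by positivity)]
    push_cast at h4 ⊢
    set L := Real.log n
    have e1 : (1 + (k + 1)) * Real.log 2 ≤ Real.log 2 + (Real.log (32 * q) + L + 44 * x) := by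
      linarith
    have hL0 : 0 < L := hl2.trans_le hL
    have e3 : L ≤ L * x := le_mul_of_one_le_right hL0.le hx1
    have e2 : Real.log 2 * Real.log 2 ≤ L * x :=
      (mul_le_of_le_one_right hl2.le hl2').trans (hL.trans e3)
    have e4 : Real.log (32 * q) * Real.log 2 ≤ Real.log (32 * q) * (L * x) :=
      mul_le_mul_of_nonneg_left (hL.trans e3) hlq
    have e5 : x * Real.log 2 ≤ L * x := by rw [mul_comm]; gcongr
    have e6 : L * Real.log 2 ≤ L * x := (mul_le_of_le_one_right hL0.le hl2').trans e3
    have e7 : 0 ≤ L * x := by positivity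
    calc (1 + ((k : ℝ) + 1)) * (Real.log 2 * Real.log 2)
        = (1 + ((k : ℝ) + 1)) * Real.log 2 * Real.log 2 := by ring
      _ ≤ (Real.log 2 + (Real.log (32 * q) + L + 44 * x)) * Real.log 2 := by gcongr
      _ ≤ (6 + Real.log (32 * q) + 44) * L * x := by linarith
  · have h1 : ((2 : ℝ) ^ weightLog n E) ≤ 2 * (n * E * 4) := by
      exact_mod_cast (weight_bounds (n := n) (by omega) hE1).2
    have h2 : (2 : ℝ) ^ weightLog n E ≤ 2 ^ 4 * (n / ε) := by
      refine h1.trans ?_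
      rw [div_eq_mul_one_div (n : ℝ) ε, ← hx]
      nlinarith
    have hne : (2 : ℝ) ≤ n / ε := by rw [le_div_iff₀ hε]; linarith
    have h3 := Real.log_le_log (by positivity) h2
    rw [Real.log_pow, Real.log_mul (by positivity) (by positivity), Real.log_pow] at h3
    have h4 : Real.log 2 ≤ Real.log (n / ε) := Real.log_le_log (by norm_num) hne
    rw [div_mul_eq_mul_div, le_div_iff₀ (by positivity)]
    push_cast at h3
    calc (weightLog n E : ℝ) * (Real.log 2 * Real.log 2)
        = (weightLog n E : ℝ) * Real.log 2 * Real.log 2 := by ring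
      _ ≤ (4 * Real.log 2 + Real.log (n / ε)) * 1 :=
          mul_le_mul h3 hl2' hl2.le (by linarith)
      _ ≤ (6 + Real.log (32 * q) + 44) * Real.log (n / ε) := by
          have := mul_nonneg hlq (hl2.le.trans h4)
          linarith

end Learner

/-! ### Assembling the learner and the sampler -/

instance {n : ℕ} (p : Fin n → unitInterval) : IsProbabilityMeasure (sampleLaw p) := by
  unfold sampleLaw; infer_instance

theorem sampleLaw_ae_le {n : ℕ} (p : Fin n → unitInterval) :
    ∀ᵐ ω ∂sampleLaw p, ∀ i, ω i ≤ n :=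
  ae_all_iff.2 fun i => (measurePreserving_eval_infinitePi
    (fun _ : ℕ => sumOfBernoullis p) i).quasiMeasurePreserving.ae (sumOfBernoullis_ae_le p)

open Learner in
theorem Learner.runs {n E : ℕ} (hn : 2 ≤ n) (hE : 1 ≤ E) {ω : ℕ → ℕ} (hω : ∀ i, ω i ≤ n) :
    ∃ s bs, Learner.prog.Runs [n, E] ω s ∧ s.out = Histogram.encode ⟨bs⟩ ∧
      s.drawn = secondCount E ∧ s.bitOps ≤
        100 * secondCount E * secondCount E * (1 + (numberBound n E).size) *
          (1 + 2 * (numberBound n E).size) ∧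
      Binned ω (firstCount E) (secondCount E) (2 ^ weightLog n E) n 0 (2 ^ weightLog n E) bs := by
  obtain ⟨bs, hbs⟩ := Binned.exists_of_le ω (firstCount E) (secondCount E) (2 ^ weightLog n E)
    (Nat.zero_le n) (2 ^ weightLog n E)
  obtain ⟨s, h1, h2, h3, h4⟩ := (Learner.prog_spec (by omega) hE hω hbs).runs
  exact ⟨s, bs, h1, h3, h4, h2, hbs⟩

-- A union bound over the failures at the two scales and the null event of a sample above `n`. Both
-- scales use the same stream, and no independence between them is needed.
open Learner in
theorem Learner.nine_tenths_le {n E : ℕ} (hn : 1 ≤ n) (hE : 1 ≤ E) (p : Fin n → unitInterval) :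
    9 / 10 ≤ (sampleLaw p).real {ω | (∀ i, ω i ≤ n) ∧ ∀ bs,
      Binned ω (firstCount E) (secondCount E) (2 ^ weightLog n E) n 0 (2 ^ weightLog n E) bs →
        Histogram.tvDist n (sumOfBernoullis p) ⟨bs⟩ ≤ 1 / E} := by
  set S := {ω : ℕ → ℕ | (∀ i, ω i ≤ n) ∧ ∀ bs,
      Binned ω (firstCount E) (secondCount E) (2 ^ weightLog n E) n 0 (2 ^ weightLog n E) bs →
        Histogram.tvDist n (sumOfBernoullis p) ⟨bs⟩ ≤ 1 / E} with hS
  have h1 := firstScale_le hE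
  have h2 := firstCount_le_secondScale hE
  have hA := empirical_uniform (sumOfBernoullis p) (sumOfBernoullis_ae_le p)
    (show 0 < firstScale E by omega) (m := firstCount E) rfl
  have hB := empirical_uniform (sumOfBernoullis p) (sumOfBernoullis_ae_le p)
    (show 0 < secondScale E by omega) (m := secondCount E) rfl
  have hC : (sampleLaw p).real {ω | ∀ i, ω i ≤ n}ᶜ = 0 := by
    rw [measureReal_def, show sampleLaw p {ω | ∀ i, ω i ≤ n}ᶜ = 0 from sampleLaw_ae_le p]
    simp
  rw [← sampleLaw] at hA hB
  set A := {ω : ℕ → ℕ | ∀ x, |(sampleCount ω (firstCount E) 0 x : ℝ) / firstCount E -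
    (sumOfBernoullis p).real (Set.Iio x)| ≤ 1 / firstScale E} with hAdef
  set B := {ω : ℕ → ℕ | ∀ x, |(sampleCount ω (secondCount E) 0 x : ℝ) / secondCount E -
    (sumOfBernoullis p).real (Set.Iio x)| ≤ 1 / secondScale E} with hBdef
  set N := {ω : ℕ → ℕ | ∀ i, ω i ≤ n} with hN
  have hcover : (Set.univ : Set (ℕ → ℕ)) ⊆ S ∪ (Aᶜ ∪ (Bᶜ ∪ Nᶜ)) := by
    intro ω _
    by_cases hωA : ω ∈ A
    · by_cases hωB : ω ∈ B
      · by_cases hωN : ω ∈ N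
        · exact .inl ⟨hωN, fun bs hbs => hbs.tvDist_le hn hE p hωA hωB⟩
        · exact .inr (.inr (.inr hωN))
      · exact .inr (.inr (.inl hωB))
    · exact .inr (.inl hωA)
  have h3 := measureReal_mono (μ := sampleLaw p) hcover (measure_ne_top _ _)
  rw [probReal_univ] at h3
  have h4 := measureReal_union_le (μ := sampleLaw p) S (Aᶜ ∪ (Bᶜ ∪ Nᶜ))
  have h5 := measureReal_union_le (μ := sampleLaw p) Aᶜ (Bᶜ ∪ Nᶜ)
  have h6 := measureReal_union_le (μ := sampleLaw p) Bᶜ Nᶜ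
  linarith

theorem theorem5 :
    ∃ (learner sampler : Prog) (C : ℝ) (c : ℕ),
      ∀ (n : ℕ) (ε : ℝ), 2 ≤ n → 0 < ε → ε ≤ 1 →
        (∀ ω : ℕ → ℕ, (∀ i, ω i ≤ n) →
          ∃ (s : MState) (H : Histogram),
            learner.Runs [n, ⌈1 / ε⌉₊] ω s ∧
            (s.drawn : ℝ) ≤ C * Real.log n * (1 / ε) ^ c ∧
            (s.bitOps : ℝ) ≤ C * Real.log n ^ 2 * (1 / ε) ^ c ∧
            s.out = H.encode ∧ H.IsOver n ∧
            (H.bins.length : ℝ) ≤ C * Real.log n * (1 / ε) ^ c ∧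
            H.SampledBy n sampler (C * Real.log (n / ε)) (C * (Real.log n + 1 / ε) ^ c)) ∧
        ∀ p : Fin n → unitInterval,
          9 / 10 ≤ (sampleLaw p).real
            {ω : ℕ → ℕ | ∃ (s : MState) (H : Histogram),
              learner.Runs [n, ⌈1 / ε⌉₊] ω s ∧ s.out = H.encode ∧
              H.tvDist n (sumOfBernoullis p) ≤ ε} := by
  obtain ⟨a, D, ha, hD, hbounds⟩ := Learner.exists_bounds
  -- The summands of `C` serve, in order, the samples and bins, the operations of the learner, the
  -- random bits, and the operations of the sampler. The exponent is `44 = 21 + 21 + 1 + 1`: two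
  -- factors `M` and two factors of the number size.
  refine ⟨Learner.prog, Sampler.prog,
    a * D + 200 * a ^ 2 * D ^ 2 + D + 46 * (a + D) * D ^ 2, 44, ?_⟩
  intro n ε hn hε hε1
  obtain ⟨hM, hs, ht⟩ := hbounds n ε hn hε hε1
  have hx1 : 1 ≤ 1 / ε := by rw [le_div_iff₀ hε]; linarith
  have hEx : 1 / ε ≤ ⌈1 / ε⌉₊ := Nat.le_ceil _
  have hE : 1 ≤ ⌈1 / ε⌉₊ := Nat.one_le_ceil_iff.2 (by linarith)
  have hL : 0 < Real.log n := Real.log_pos (by exact_mod_cast (show 1 < n by omega))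
  have hLe : 0 < Real.log (n / ε) := Real.log_pos (by
    rw [lt_div_iff₀ hε]
    have : (2 : ℝ) ≤ n := by exact_mod_cast hn
    linarith)
  have hT : (1 : ℝ) / ⌈1 / ε⌉₊ ≤ ε := by
    rw [div_le_iff₀ (by exact_mod_cast hE)]
    rw [div_le_iff₀ hε] at hEx
    linarith
  have hbd := Learner.numberBound_bounds (n := n) (by omega) hE
  have hKs := Learner.firstCount_le_secondScale hE
  have hsM := Learner.secondScale_cube_le hE
  have hw := Learner.weight_bounds (n := n) (by omega) hE
  generalize hEdef : ⌈1 / ε⌉₊ = E at *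
  generalize hxdef : 1 / ε = x at *
  set L := Real.log n with hLdef
  set M := Learner.secondCount E with hMdef
  set B := Learner.numberBound n E with hBdef
  have hs0 : (0 : ℝ) ≤ B.size := by positivity
  have hDLx : 1 ≤ D * L * x := by linarith
  have hx0 : 0 < x := by linarith
  have hMC : (M : ℝ) ≤ (a * D + 200 * a ^ 2 * D ^ 2 + D + 46 * (a + D) * D ^ 2) * L * x ^ 44 := by
    calc (M : ℝ) ≤ a * x ^ 21 := hM
      _ ≤ a * x ^ 21 * (D * L * x) := le_mul_of_one_le_right (by positivity) hDLx
      _ = a * D * L * x ^ 22 := by ring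
      _ ≤ a * D * L * x ^ 44 := by gcongr; norm_num
      _ ≤ _ := by
        gcongr
        have : 0 ≤ 200 * a ^ 2 * D ^ 2 + D + 46 * (a + D) * D ^ 2 := by positivity
        linarith
  refine ⟨fun ω hω => ?_, fun p => ?_⟩
  · obtain ⟨s, bs, hrun, hout, hdrawn, hops, hbs⟩ := Learner.runs hn hE hω
    have hlen := hbs.length_le
    have hlenM : bs.length ≤ M := by omega
    have hr : sampleCount ω M 0 n * 2 ^ Learner.weightLog n E ≤ M * 2 ^ Learner.weightLog n E :=
      Nat.mul_le_mul_right _ (sampleCount_le _ _ _ _)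
    have hwt := hbs.wt_eq (by omega) hr
    have hover : Histogram.IsOver ⟨bs⟩ n :=
      ⟨hbs.fst_pos, hbs.len_eq, Nat.lt_of_lt_of_eq (by positivity) hwt.symm⟩
    refine ⟨s, ⟨bs⟩, hrun, ?_, ?_, hout, hover, ?_, ?_⟩
    · rw [hdrawn]; exact hMC
    · calc (s.bitOps : ℝ) ≤ ((100 * M * M * (1 + B.size) * (1 + 2 * B.size) : ℕ) : ℝ) := by
            exact_mod_cast hops
        _ = 100 * (M : ℝ) * M * (1 + B.size) * (1 + 2 * B.size) := by push_cast; ring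
        _ ≤ 100 * (a * x ^ 21) * (a * x ^ 21) * (D * L * x) * (2 * (D * L * x)) := by
            gcongr
            linarith
        _ = 200 * a ^ 2 * D ^ 2 * L ^ 2 * x ^ 44 := by ring
        _ ≤ _ := by
          gcongr
          have : 0 ≤ a * D + D + 46 * (a + D) * D ^ 2 := by positivity
          linarith
    · exact le_trans (by exact_mod_cast hlenM) hMC
    · refine Sampler.sampledBy (B := B) (t := Learner.weightLog n E) hover hbs.fst_dvd_snd hwt
        (by simp only; omega) (by omega) (by omega) (ht.trans ?_) ?_
      · gcongr
        have : 0 ≤ a * D + 200 * a ^ 2 * D ^ 2 + 46 * (a + D) * D ^ 2 := by positivity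
        linarith
      · have htB : Learner.weightLog n E ≤ B.size := by
          have := Nat.size_le_size (m := 2 ^ Learner.weightLog n E) (n := B) (by omega)
          rw [Nat.size_pow] at this
          omega
        have hz1 : 1 ≤ L + x := by linarith
        have hxz : x ≤ L + x := by linarith
        -- The sampler may spend powers of `log n + 1 / ε`, so the product `log n * (1 / ε)` is
        -- bounded by the square of the sum; the exponent needed is `21 + 2 + 2`.
        have hsz : (1 + B.size : ℝ) ≤ D * (L + x) ^ 2 := by
          calc (1 + B.size : ℝ) ≤ D * L * x := hs
            _ ≤ D * (L + x) * (L + x) := by gcongr; linarith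
            _ = _ := by ring
        calc _ ≤ (((M + (1 + B.size)) * (23 + 2 * B.size) * (1 + 2 * B.size) : ℕ) : ℝ) := by
              norm_cast
              gcongr ?_ * _ * _
              simp only
              omega
          _ = ((M : ℝ) + (1 + B.size)) * (23 + 2 * B.size) * (1 + 2 * B.size) := by
              push_cast; ring
          _ ≤ (a * (L + x) ^ 21 + D * (L + x) ^ 21) * (23 * (D * (L + x) ^ 2)) *
              (2 * (D * (L + x) ^ 2)) := by
              gcongr
              · exact hM.trans (by gcongr)
              · exact hsz.trans (by gcongr; norm_num)
              · linarith
              · linarith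
          _ = 46 * (a + D) * D ^ 2 * (L + x) ^ 25 := by ring
          _ ≤ 46 * (a + D) * D ^ 2 * (L + x) ^ 44 := by gcongr; norm_num
          _ ≤ _ := by
            gcongr
            have : 0 ≤ a * D + 200 * a ^ 2 * D ^ 2 + D := by positivity
            linarith
  · refine (Learner.nine_tenths_le (by omega) hE p).trans ?_
    refine measureReal_mono ?_ (measure_ne_top _ _)
    rintro ω ⟨hω, htv⟩
    obtain ⟨s, bs, hrun, hout, -, -, hbs⟩ := Learner.runs hn hE hω
    exact ⟨s, ⟨bs⟩, hrun, hout, (htv bs hbs).trans hT⟩
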